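/- **Setting.** A *prefix machine* is a partial computable function $M:\{0,1\}^*\rightharpoonup\{0,1\}^*$ whose domain is prefix-free. Fix a *universal* prefix machine $U$, i.e. a prefix machine such that for every prefix machine $M$ there is a constant $c$ such that whenever $M(\pi)=w$ there is $\rho$ with $|\rho|\le|\pi|+c$ and $U(\rho)=w$. Let $K(w)=\min\{|\pi| : U(\pi)=w\}$, and extend $K$ to rational points $q\in\mathbb{Q}^n$ by a standard binary encoding of $\mathbb{Q}^n$. For $x\in\mathbb{R}^n$ and $r\in\mathbb{N}$ let $$K_r(x)=\min\{K(q) : q\in\mathbb{Q}^n,\ |q-x|<2^{-r}\},$$ $$\dim(x)=\liminf_{r\to\infty}\frac{K_r(x)}{r},\qquad \mathrm{Dim}(x)=\limsup_{r\to\infty}\frac{K_r(x)}{r}.$$ For a finite outer measure $\mu$ on $\mathbb{R}^n$, the lower and upper local dimensions of $\mu$ at $x$ are $$(\dim_{\mathrm{loc}}\mu)(x)=\liminf_{r\to\infty}\frac{\log_2\frac{1}{\mu(B(x,2^{-r}))}}{r},\qquad (\mathrm{Dim}_{\mathrm{loc}}\,\mu)(x)=\limsup_{r\to\infty}\frac{\log_2\frac{1}{\mu(B(x,2^{-r}))}}{r},$$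 where $B(x,\varepsilon)$ is the open Euclidean ball of radius $\varepsilon$ about $x$. An outer measure $\mu$ on $\mathbb{R}^n$ is - *strongly finite* if $\mu(\mathbb{R}^n\setminus\mathbb{Q}^n)=0$ and $\sum_{q\in\mathbb{Q}^n}\mu(\{q\})<\infty$; - *lower semicomputable* if (a) for every $\varepsilon>0$ there is a finite $A\subseteq\mathbb{Q}^n$ with $\mu(\mathbb{R}^n\setminus A)<\varepsilon$, and (b) there is a computable function $\hat\mu$ taking a finite set $A\subseteq\mathbb{Q}^n$ and $t\in\mathbb{N}$ to $\hat\mu(A,t)\in\mathbb{Q}\cap[0,\infty)$ such that $\hat\mu(A,s)\le\hat\mu(A,t)\le\mu(A)$ whenever $s\le t$, and $\lim_{t\to\infty}\hat\mu(A,t)=\mu(A)$, for every finite $A\subseteq\mathbb{Q}^n$; - *locally optimal* if $\mu$ is strongly finite and lower semicomputable and, for every strongly finite, lower semicomputable outer measure $\nu$ on $\mathbb{R}^n$, there is a function $\beta:\mathbb{N}\to(0,\infty)$ with $\beta(r)=2^{-o(r)}$ as $r\to\infty$ such that, for every $r\in\mathbb{N}$ and every $r$-dyadic cube $Q=\prod_{i=1}^n[2^{-r}m_i,2^{-r}(m_i+1))$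 with $m\in\mathbb{Z}^n$, $$\mu(Q)\ge\beta(r)\,\nu(Q).$$ **Theorem.** If $\mu$ is any locally optimal outer measure on $\mathbb{R}^n$, then for all $x\in\mathbb{R}^n$, $$(\dim_{\mathrm{loc}}\mu)(x)=\dim(x)\qquad\text{and}\qquad(\mathrm{Dim}_{\mathrm{loc}}\,\mu)(x)=\mathrm{Dim}(x).$$ -/

import Mathlib

open Filter Topology MeasureTheory Asymptotics
open scoped NNReal ENNReal

noncomputable section

namespace AlgDim

/-! ### Prefix machines and Kolmogorov complexity -/

/-- A prefix machine: a partial computable function on binary strings whose domain is prefix-free. -/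
structure IsPrefixMachine (M : List Bool →. List Bool) : Prop where
  partrec : Partrec M
  prefixFree : ∀ π ρ : List Bool, (M π).Dom → (M ρ).Dom → π <+: ρ → π = ρ

/-- A universal prefix machine: a prefix machine that simulates every prefix machine with at most a
constant increase of the program length. (Machines that simulate through a fixed program prefix for
each `M` are a special case.) -/
structure IsUniversalPrefixMachine (U : List Bool →. List Bool) : Prop where
  isPrefixMachine : IsPrefixMachine U
  universal : ∀ M : List Bool →. List Bool, IsPrefixMachine M →
    ∃ c : ℕ, ∀ π w : List Bool, w ∈ M π → ∃ ρ : List Bool, ρ.length ≤ π.length + c ∧ w ∈ U ρ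

/-- Prefix Kolmogorov complexity of a string: the least length of a `U`-program for it. When `U` is
universal, every string has a program, so the minimum is over a nonempty set. -/
def complexity (U : List Bool →. List Bool) (w : List Bool) : ℕ :=
  sInf {k : ℕ | ∃ π : List Bool, w ∈ U π ∧ k = π.length}

/-- The standard code of a rational number: numerator and denominator in lowest terms. -/
def ratCode (q : ℚ) : ℤ × ℕ := (q.num, q.den)

/-- The code of a rational point: the tuple of the codes of its coordinates. -/
def pointCode {n : ℕ} (q : Fin n → ℚ) : Fin n → ℤ × ℕ := fun i => ratCode (q i)

/-- The binary string that encodes an element: the binary digits of its number in the (computable)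
numbering of the type. -/
def binaryString {α : Type*} [Primcodable α] (a : α) : List Bool := Nat.bits (Encodable.encode a)

/-- The binary string that encodes a rational point. -/
def pointString {n : ℕ} (q : Fin n → ℚ) : List Bool := binaryString (pointCode q)

/-- Kolmogorov complexity `K(q)` of a rational point. -/
def pointComplexity (U : List Bool →. List Bool) {n : ℕ} (q : Fin n → ℚ) : ℕ :=
  complexity U (pointString q)

/-- The rational point `q`, regarded as a point of Euclidean space. -/
def ratPoint {n : ℕ} (q : Fin n → ℚ) : EuclideanSpace ℝ (Fin n) :=
  WithLp.toLp 2 fun i => (q i : ℝ)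

/-- `K_r(x)`: the least complexity of a rational point at distance less than `2^{-r}` from `x`. -/
def complexityAt (U : List Bool →. List Bool) {n : ℕ} (r : ℕ) (x : EuclideanSpace ℝ (Fin n)) : ℕ :=
  sInf {k : ℕ | ∃ q : Fin n → ℚ, dist (ratPoint q) x < ((2 : ℝ) ^ r)⁻¹ ∧ k = pointComplexity U q}

/-- Algorithmic dimension `dim(x)`. -/
def algDim (U : List Bool →. List Bool) {n : ℕ} (x : EuclideanSpace ℝ (Fin n)) : EReal :=
  liminf (fun r : ℕ => (((complexityAt U r x : ℝ) / (r : ℝ) : ℝ) : EReal)) atTop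

/-- Strong algorithmic dimension `Dim(x)`. -/
def strongAlgDim (U : List Bool →. List Bool) {n : ℕ} (x : EuclideanSpace ℝ (Fin n)) : EReal :=
  limsup (fun r : ℕ => (((complexityAt U r x : ℝ) / (r : ℝ) : ℝ) : EReal)) atTop

/-! ### Local dimensions of outer measures -/

/-- `log₂ (1 / a)` for `a ∈ [0, ∞]`, with value `∞` at `a = 0`. -/
def negLogTwo (a : ℝ≥0∞) : EReal := ENNReal.log a⁻¹ / ((Real.log 2 : ℝ) : EReal)

/-- Lower local dimension of `μ` at `x`. -/
def lowerLocalDim {n : ℕ} (μ : OuterMeasure (EuclideanSpace ℝ (Fin n)))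
    (x : EuclideanSpace ℝ (Fin n)) : EReal :=
  liminf (fun r : ℕ => negLogTwo (μ (Metric.ball x ((2 : ℝ) ^ r)⁻¹)) / ((r : ℝ) : EReal)) atTop

/-- Upper local dimension of `μ` at `x`. -/
def upperLocalDim {n : ℕ} (μ : OuterMeasure (EuclideanSpace ℝ (Fin n)))
    (x : EuclideanSpace ℝ (Fin n)) : EReal :=
  limsup (fun r : ℕ => negLogTwo (μ (Metric.ball x ((2 : ℝ) ^ r)⁻¹)) / ((r : ℝ) : EReal)) atTop

/-! ### Strongly finite and lower semicomputable outer measures -/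

/-- `μ` is finitely supported on the rational points. -/
def FinitelySupported {n : ℕ} (μ : OuterMeasure (EuclideanSpace ℝ (Fin n))) : Prop :=
  ∀ ε : ℝ≥0∞, 0 < ε → ∃ A : Finset (Fin n → ℚ), μ (ratPoint '' (A : Set (Fin n → ℚ)))ᶜ < ε

/-- `μ` is supported on the rational points and the masses of the rational points have finite sum. -/
def StronglyFinite {n : ℕ} (μ : OuterMeasure (EuclideanSpace ℝ (Fin n))) : Prop :=
  μ (Set.range (ratPoint (n := n)))ᶜ = 0 ∧ ∑' q : Fin n → ℚ, μ {ratPoint q} < ∞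

/-- Computability of a function on finite sets of rational points and natural numbers, with rational
values: an algorithm computes the code of the value from any list of the codes of the points of the
set (in any order, repetitions allowed) and the number. -/
def ComputableApprox {n : ℕ} (f : Finset (Fin n → ℚ) → ℕ → ℚ≥0) : Prop :=
  ∃ F : List (Fin n → ℤ × ℕ) → ℕ → ℤ × ℕ, Computable₂ F ∧
    ∀ (l : List (Fin n → ℚ)) (t : ℕ), F (l.map pointCode) t = ratCode (f l.toFinset t : ℚ)

/-- Lower semicomputable outer measures. -/
def LowerSemicomputable {n : ℕ} (μ : OuterMeasure (EuclideanSpace ℝ (Fin n))) : Prop :=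
  FinitelySupported μ ∧
  ∃ f : Finset (Fin n → ℚ) → ℕ → ℚ≥0, ComputableApprox f ∧
    (∀ (A : Finset (Fin n → ℚ)) (s t : ℕ), s ≤ t →
      f A s ≤ f A t ∧ (((f A t : ℝ≥0) : ℝ≥0∞) ≤ μ (ratPoint '' (A : Set (Fin n → ℚ))))) ∧
    ∀ A : Finset (Fin n → ℚ),
      Tendsto (fun t : ℕ => ((f A t : ℝ≥0) : ℝ≥0∞)) atTop
        (𝓝 (μ (ratPoint '' (A : Set (Fin n → ℚ)))))

/-! ### Local optimality -/

/-- The `r`-dyadic cube with address `m`. -/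
def dyadicCube {n : ℕ} (r : ℕ) (m : Fin n → ℤ) : Set (EuclideanSpace ℝ (Fin n)) :=
  {x | ∀ i, (m i : ℝ) / 2 ^ r ≤ x i ∧ x i < ((m i : ℝ) + 1) / 2 ^ r}

/-- `μ` dominates `ν` on the families `𝒜 r`: `μ E ≥ β r * ν E` for all `E ∈ 𝒜 r`, where
`β r = 2^{-o(r)}`, that is, `β r > 0` and `log₂ (β r) = o(r)`. -/
def DominatesOn {n : ℕ} (μ ν : OuterMeasure (EuclideanSpace ℝ (Fin n)))
    (𝒜 : ℕ → Set (Set (EuclideanSpace ℝ (Fin n)))) : Prop :=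
  ∃ β : ℕ → ℝ, (∀ r, 0 < β r) ∧
    (fun r : ℕ => Real.logb 2 (β r)) =o[atTop] (fun r : ℕ => (r : ℝ)) ∧
    ∀ r : ℕ, ∀ E ∈ 𝒜 r, ENNReal.ofReal (β r) * ν E ≤ μ E

/-- `μ` dominates `ν` on dyadic cubes. -/
def DominatesOnDyadicCubes {n : ℕ} (μ ν : OuterMeasure (EuclideanSpace ℝ (Fin n))) : Prop :=
  DominatesOn μ ν fun r => Set.range (dyadicCube r)

/-- Locally optimal outer measures. -/
structure LocallyOptimal {n : ℕ} (μ : OuterMeasure (EuclideanSpace ℝ (Fin n))) : Prop where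
  stronglyFinite : StronglyFinite μ
  lowerSemicomputable : LowerSemicomputable μ
  dominates : ∀ ν : OuterMeasure (EuclideanSpace ℝ (Fin n)),
    StronglyFinite ν → LowerSemicomputable ν → DominatesOnDyadicCubes μ ν

end AlgDim

end

noncomputable section

namespace AlgDim

/-! ### Primitive recursive arithmetic -/

/-! Both dimensions compare with `r` the quantities `-log₂ μ(B(x, 2^{-r}))` and `K_r(x)`. These
agree up to a bounded shift of `r` and an error absorbed by any `ε > 0`, so each direction is an
inequality of growth rates.

Mass is large where complexity is small. Giving each program `π` that outputs a rational point the
mass `2^{-|π|}` there defines `programMeasure U n`. It is strongly finite by the Kraft inequality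
and lower semicomputable by running the programs for more and more steps. Local optimality makes `μ`
dominate it on dyadic cubes. A small cube around a simplest rational point `q` near `x` lies in the
ball, so the ball has mass at least `2^{-o(r)} 2^{-K(q)}` (`LocallyOptimal.exists_le_measure_ball`).

Complexity is small where mass is large. This half uses only that `μ` is strongly finite and lower
semicomputable. The level `r` cubes of mass above `2^{-s}` can be enumerated, and there are at most
`2^{s+w}` of them if the total mass is at most `2^w`. A self-delimiting code of `(r, s)` and an
index of `s + w` bits therefore describe such a cube, whence
`exists_pointComplexity_dyadicCorner_le`. A ball meets at most `3^n` cubes of comparable side, so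
one of them carries a fixed fraction of its mass, and the corner of that cube approximates `x`
(`exists_complexityAt_le`).

The overhead `O(log (r + s))` is at most `ε (r + s) + O(1)`. Hence the comparison has the form `a r
≤ (1 + ε) b (r + k) + ε r`, which `liminf_div_le_of_growth_le` and `limsup_div_le_of_growth_le`
carry over to the lower and upper dimensions. -/

theorem primrec_nat_pow : Primrec₂ ((· ^ ·) : ℕ → ℕ → ℕ) :=
  Primrec₂.unpaired'.1 Nat.Primrec.pow

/-- The numbering of `ℤ` interleaves the signs, so positive and negative parts can be read off by
parity. All integer arithmetic below is reduced to these two natural numbers. -/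
theorem encode_int_natCast (k : ℕ) : Encodable.encode (k : ℤ) = 2 * k := rfl

theorem encode_int_negSucc (k : ℕ) : Encodable.encode (Int.negSucc k) = 2 * k + 1 := rfl

theorem primrec_int_toNat : Primrec Int.toNat := by
  have h : Primrec fun z : ℤ =>
      if Encodable.encode z % 2 = 0 then Encodable.encode z / 2 else 0 :=
    Primrec.ite (Primrec.eq.comp (Primrec.nat_mod.comp Primrec.encode (Primrec.const 2))
      (Primrec.const 0)) (Primrec.nat_div.comp Primrec.encode (Primrec.const 2)) (Primrec.const 0)
  refine h.of_eq fun z => ?_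
  cases z with
  | ofNat k =>
    have := encode_int_natCast k
    simp only [Int.ofNat_eq_natCast, this, Int.toNat_natCast]; split_ifs <;> omega
  | negSucc k => rw [encode_int_negSucc, if_neg (by omega)]; rfl

theorem primrec_int_neg_toNat : Primrec fun z : ℤ => (-z).toNat := by
  have h : Primrec fun z : ℤ =>
      if Encodable.encode z % 2 = 0 then 0 else Encodable.encode z / 2 + 1 :=
    Primrec.ite (Primrec.eq.comp (Primrec.nat_mod.comp Primrec.encode (Primrec.const 2))
      (Primrec.const 0)) (Primrec.const 0)
      (Primrec.succ.comp (Primrec.nat_div.comp Primrec.encode (Primrec.const 2)))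
  refine h.of_eq fun z => ?_
  cases z with
  | ofNat k =>
    have := encode_int_natCast k
    simp only [Int.ofNat_eq_natCast, this]; split_ifs <;> omega
  | negSucc k => rw [encode_int_negSucc, if_neg (by omega)]; omega

theorem primrec_int_subNat : Primrec₂ fun p q : ℕ => (p : ℤ) - (q : ℤ) := by
  rw [← Primrec₂.encode_iff]
  have h : Primrec₂ fun p q : ℕ => if q ≤ p then 2 * (p - q) else 2 * (q - p - 1) + 1 :=
    Primrec.ite (Primrec.nat_le.comp Primrec.snd Primrec.fst)
      (Primrec.nat_double.comp (Primrec.nat_sub.comp Primrec.fst Primrec.snd))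
      (Primrec.nat_double_succ.comp
        (Primrec.nat_sub.comp (Primrec.nat_sub.comp Primrec.snd Primrec.fst) (Primrec.const 1)))
  refine h.of_eq fun p q => ?_
  split_ifs with hpq
  · rw [← Nat.cast_sub hpq, encode_int_natCast]
  · have : (p : ℤ) - q = Int.negSucc (q - p - 1) := by omega
    rw [this, encode_int_negSucc]

theorem primrec_int_mul : Primrec₂ ((· * ·) : ℤ → ℤ → ℤ) := by
  have a := primrec_int_toNat.comp (Primrec.fst (α := ℤ) (β := ℤ))
  have b := primrec_int_neg_toNat.comp (Primrec.fst (α := ℤ) (β := ℤ))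
  have c := primrec_int_toNat.comp (Primrec.snd (α := ℤ) (β := ℤ))
  have d := primrec_int_neg_toNat.comp (Primrec.snd (α := ℤ) (β := ℤ))
  have h := primrec_int_subNat.comp
    (Primrec.nat_add.comp (Primrec.nat_mul.comp a c) (Primrec.nat_mul.comp b d))
    (Primrec.nat_add.comp (Primrec.nat_mul.comp a d) (Primrec.nat_mul.comp b c))
  refine Primrec.of_eq h fun ⟨x, y⟩ => ?_
  have hx := Int.toNat_sub_toNat_neg x
  have hy := Int.toNat_sub_toNat_neg y
  push_cast
  conv_rhs => rw [← hx, ← hy]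
  ring

theorem primrec_int_natCast : Primrec fun k : ℕ => (k : ℤ) :=
  (primrec_int_subNat.comp Primrec.id (Primrec.const 0)).of_eq fun k => by simp

theorem primrec_int_succ : Primrec fun z : ℤ => z + 1 :=
  (primrec_int_subNat.comp (Primrec.succ.comp primrec_int_toNat) primrec_int_neg_toNat).of_eq
    fun z => by have := Int.toNat_sub_toNat_neg z; push_cast; omega

theorem primrec_int_le : PrimrecRel ((· ≤ ·) : ℤ → ℤ → Prop) := by
  have h := Primrec.nat_le.comp
    (Primrec.nat_add.comp (primrec_int_toNat.comp (Primrec.fst (α := ℤ) (β := ℤ)))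
      (primrec_int_neg_toNat.comp (Primrec.snd (α := ℤ) (β := ℤ))))
    (Primrec.nat_add.comp (primrec_int_toNat.comp (Primrec.snd (α := ℤ) (β := ℤ)))
      (primrec_int_neg_toNat.comp (Primrec.fst (α := ℤ) (β := ℤ))))
  exact PrimrecPred.of_eq h fun ⟨x, y⟩ => by
    have hx := Int.toNat_sub_toNat_neg x
    have hy := Int.toNat_sub_toNat_neg y
    simp only
    omega

theorem primrec_int_lt : PrimrecRel ((· < ·) : ℤ → ℤ → Prop) :=
  (primrec_int_le.swap.not).of_eq fun x y => by simp [Function.swap]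

/-- The gcd is found by bounded search for the greatest common divisor. The bound `a + b` also
covers the case where one argument is zero. -/
theorem primrec_nat_gcd : Primrec₂ Nat.gcd := by
  have hd : PrimrecRel fun (p : ℕ × ℕ) (d : ℕ) => p.1 % d = 0 ∧ p.2 % d = 0 :=
    PrimrecPred.and
      (Primrec.eq.comp (Primrec.nat_mod.comp (Primrec.fst.comp Primrec.fst) Primrec.snd)
        (Primrec.const 0))
      (Primrec.eq.comp (Primrec.nat_mod.comp (Primrec.snd.comp Primrec.fst) Primrec.snd)
        (Primrec.const 0))
  have h := Primrec.nat_findGreatest (f := fun p : ℕ × ℕ => p.1 + p.2)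
    (Primrec.nat_add.comp Primrec.fst Primrec.snd) hd
  refine Primrec.of_eq h fun ⟨a, b⟩ => ?_
  rw [Nat.findGreatest_eq_iff]
  refine ⟨?_, fun _ => ⟨Nat.mod_eq_zero_of_dvd (Nat.gcd_dvd_left a b),
    Nat.mod_eq_zero_of_dvd (Nat.gcd_dvd_right a b)⟩, fun d hd hd' hh => ?_⟩
  · rcases Nat.eq_zero_or_pos a with rfl | ha
    · simp
    · exact (Nat.gcd_le_left b ha).trans (Nat.le_add_right _ _)
  · have hg := Nat.dvd_gcd (Nat.dvd_of_mod_eq_zero hh.1) (Nat.dvd_of_mod_eq_zero hh.2)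
    rcases Nat.eq_zero_or_pos (a.gcd b) with h0 | h0
    · rw [Nat.gcd_eq_zero_iff] at h0; simp only at hd'; omega
    · exact absurd (Nat.le_of_dvd h0 hg) (by simpa using hd)

theorem primrec_nat_bits : Primrec Nat.bits := by
  have hg : Primrec₂ fun (_ : Unit) (l : List (List Bool)) =>
      if l.length = 0 then some [] else
        (l[l.length.div2]?).map fun b => l.length.bodd :: b := by
    have hlen : Primrec fun p : Unit × List (List Bool) => p.2.length :=
      Primrec.list_length.comp Primrec.snd
    refine Primrec.ite (Primrec.eq.comp hlen (Primrec.const 0)) (Primrec.const _) ?_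
    refine Primrec.option_map
      (Primrec.list_getElem?.comp Primrec.snd (Primrec.nat_div2.comp hlen)) ?_
    exact Primrec.list_cons.comp (Primrec.nat_bodd.comp (hlen.comp Primrec.fst)) Primrec.snd
  have h := Primrec.nat_strong_rec (fun (_ : Unit) (k : ℕ) => Nat.bits k) hg fun _ k => by
    rcases Nat.eq_zero_or_pos k with rfl | hk
    · simp
    · have h2 : k.div2 < k := by rw [Nat.div2_val]; omega
      simp only [List.length_map, List.length_range, hk.ne', if_false, List.getElem?_map,
        List.getElem?_range h2, Option.map_some]
      congr 1
      conv_rhs => rw [← Nat.bit_bodd_div2 k]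
      rw [Nat.bits_append_bit]
      intro h0
      by_contra hb
      have := Nat.bit_bodd_div2 k
      rw [h0] at this
      simp at hb; rw [hb] at this; simp at this; omega
  exact h.comp (Primrec.const ()) Primrec.id

theorem primrec_list_replicate {α : Type*} [Primcodable α] (a : α) :
    Primrec fun k : ℕ => List.replicate k a :=
  (Primrec.list_map Primrec.list_range (g := fun _ _ => a) (Primrec₂.const a)).of_eq
    fun k => by simp

theorem primrec_binaryString {α : Type*} [Primcodable α] : Primrec (binaryString (α := α)) :=
  primrec_nat_bits.comp Primrec.encode

/-- The natural number with the given binary digits, least significant digit first. -/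
def bitsValue : List Bool → ℕ := List.foldr Nat.bit 0

theorem bitsValue_append_replicate_false (l : List Bool) (k : ℕ) :
    bitsValue (l ++ List.replicate k false) = bitsValue l := by
  induction l with
  | nil =>
    induction k with
    | zero => rfl
    | succ k ih =>
      simp only [bitsValue, List.nil_append, List.replicate_succ, List.foldr_cons,
        List.foldr_nil] at ih ⊢
      rw [ih]; rfl
  | cons b l ih =>
    simp only [bitsValue, List.cons_append, List.foldr_cons] at ih ⊢
    rw [ih]

theorem bitsValue_bits (k : ℕ) : bitsValue k.bits = k := by
  induction k using Nat.binaryRec' with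
  | zero => simp [bitsValue]
  | bit b k h ih =>
    rw [Nat.bits_append_bit k b h]
    simp only [bitsValue, List.foldr_cons] at ih ⊢
    rw [ih]

theorem bits_injective : Function.Injective Nat.bits :=
  Function.LeftInverse.injective bitsValue_bits

theorem binaryString_injective {α : Type*} [Primcodable α] :
    Function.Injective (binaryString (α := α)) :=
  bits_injective.comp Encodable.encode_injective

theorem primrecPred_forall_fin {α : Type*} [Primcodable α] {n : ℕ} {p : α → Fin n → Prop}
    (hp : ∀ i, PrimrecPred fun a => p a i) : PrimrecPred fun a => ∀ i, p a i := by
  classical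
  have h1 : Primrec₂ fun (i : Fin n) (a : α) => decide (p a i) :=
    Primrec.fin_curry₁.2 fun i => (hp i).decide
  have h2 : PrimrecRel fun (i : Fin n) (a : α) => p a i := h1.primrecRel
  exact PrimrecPred.of_eq (h2.forall_mem_list.comp (Primrec.const (List.finRange n)) Primrec.id)
    fun a => by simp

/-! ### Codes of rational points -/

theorem ratCode_injective : Function.Injective ratCode := fun p q h => by
  simp only [ratCode, Prod.mk.injEq] at h
  exact Rat.ext h.1 h.2

theorem pointCode_injective {n : ℕ} : Function.Injective (pointCode (n := n)) :=
  fun _ _ h => funext fun i => ratCode_injective (congrFun h i)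

theorem pointString_injective {n : ℕ} : Function.Injective (pointString (n := n)) :=
  binaryString_injective.comp pointCode_injective

theorem ratPoint_injective {n : ℕ} : Function.Injective (ratPoint (n := n)) := fun p q h => by
  funext i
  have := congrFun (congrArg WithLp.ofLp h) i
  simpa [ratPoint] using this

theorem primrec_ratCode_mkRat : Primrec₂ fun (a : ℤ) (b : ℕ) => ratCode (mkRat a b) := by
  have ha := primrec_int_toNat.comp (Primrec.fst (α := ℤ) (β := ℕ))
  have hb := primrec_int_neg_toNat.comp (Primrec.fst (α := ℤ) (β := ℕ))
  have hg := primrec_nat_gcd.comp (Primrec.nat_add.comp ha hb) (Primrec.snd (α := ℤ) (β := ℕ))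
  have h := Primrec.ite (Primrec.eq.comp (Primrec.snd (α := ℤ) (β := ℕ)) (Primrec.const 0))
    (Primrec.const ((0, 1) : ℤ × ℕ))
    (Primrec.pair (primrec_int_subNat.comp (Primrec.nat_div.comp ha hg)
      (Primrec.nat_div.comp hb hg)) (Primrec.nat_div.comp Primrec.snd hg))
  refine Primrec.of_eq h fun ⟨a, b⟩ => ?_
  by_cases hb0 : b = 0
  · simp [hb0, ratCode]
  · have hab : a.toNat + (-a).toNat = a.natAbs := by omega
    simp only [hb0, if_false, hab, ratCode, mkRat, dite_false, Rat.normalize_eq]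
    refine Prod.ext ?_ rfl
    simp only
    rcases le_total 0 a with h0 | h0
    · obtain ⟨k, rfl⟩ := Int.eq_ofNat_of_zero_le h0
      simp
    · obtain ⟨k, hk⟩ := Int.eq_ofNat_of_zero_le (neg_nonneg.2 h0)
      obtain rfl : a = -(k : ℤ) := by omega
      have hd : ((k.gcd b : ℕ) : ℤ) ∣ k := Int.natCast_dvd_natCast.2 (Nat.gcd_dvd_left k b)
      simp [Int.neg_ediv_of_dvd hd]

/-- The rational point whose coordinates are the given, not necessarily reduced, fractions. -/
def fracPoint {n : ℕ} (c : Fin n → ℤ × ℕ) : Fin n → ℚ := fun i => mkRat (c i).1 (c i).2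

theorem fracPoint_pointCode {n : ℕ} (q : Fin n → ℚ) : fracPoint (pointCode q) = q :=
  funext fun i => by simp [fracPoint, pointCode, ratCode, Rat.mkRat_self]

/-- Normalising fractions is primitive recursive, so searches may range over arbitrary integer pairs
instead of reduced codes only. -/
theorem primrec_pointCode_fracPoint {n : ℕ} :
    Primrec fun c : Fin n → ℤ × ℕ => pointCode (fracPoint c) := by
  refine Primrec.fin_curry.2 ?_
  have h : Primrec₂ fun (c : Fin n → ℤ × ℕ) (i : Fin n) => c i := Primrec.fin_app
  exact primrec_ratCode_mkRat.comp (Primrec.fst.comp h) (Primrec.snd.comp h)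

/-! ### The Kraft inequality for prefix machines -/

/-- The first words of two factorisations of one string are both prefixes of it, hence comparable,
hence equal; cancel and induct. -/
theorem uniquelyDecodable_of_prefixFree {α : Type*} {S : Set (List α)} (h0 : [] ∉ S)
    (hS : ∀ π ∈ S, ∀ ρ ∈ S, π <+: ρ → π = ρ) : InformationTheory.UniquelyDecodable S := by
  intro L₁
  induction L₁ with
  | nil =>
    intro L₂ _ h₂ h
    cases L₂ with
    | nil => rfl
    | cons w L =>
      have hw : w = [] := by simp at h; exact h.1
      exact absurd (hw ▸ h₂ w (by simp)) h0
  | cons v L₁ ih =>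
    intro L₂ h₁ h₂ h
    cases L₂ with
    | nil =>
      have hv : v = [] := by simp at h; exact h.1
      exact absurd (hv ▸ h₁ v (by simp)) h0
    | cons w L₂ =>
      have hv := h₁ v (by simp)
      have hw := h₂ w (by simp)
      simp only [List.flatten_cons] at h
      have hvw : v = w := by
        rcases List.prefix_or_prefix_of_prefix (List.prefix_append v L₁.flatten)
          (h ▸ List.prefix_append w L₂.flatten) with hp | hp
        · exact hS v hv w hw hp
        · exact (hS w hw v hv hp).symm
      subst hvw
      rw [ih L₂ (fun x hx => h₁ x (by simp [hx])) (fun x hx => h₂ x (by simp [hx]))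
        (List.append_cancel_left h)]

/-- The weight `2^{-|π|}` of a program. -/
def programWeight (π : List Bool) : ℝ≥0∞ := 2⁻¹ ^ π.length

theorem programWeight_eq_ofReal (π : List Bool) :
    programWeight π = ENNReal.ofReal ((1 / 2) ^ π.length) := by
  rw [programWeight, ENNReal.ofReal_pow (by norm_num), one_div, ENNReal.ofReal_inv_of_pos two_pos]
  simp

theorem tsum_programWeight_le_one {S : Set (List Bool)}
    (hS : ∀ π ∈ S, ∀ ρ ∈ S, π <+: ρ → π = ρ) : ∑' π, S.indicator programWeight π ≤ 1 := by
  classical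
  -- The empty word spoils unique decodability, but a prefix-free set containing it is a singleton
  -- of weight `1`.
  by_cases h0 : [] ∈ S
  · have hS' : S = {[]} := Set.eq_singleton_iff_unique_mem.2
      ⟨h0, fun π hπ => (hS [] h0 π hπ List.nil_prefix).symm⟩
    rw [hS', tsum_eq_single [] fun π hπ => by simp [hπ]]
    simp [programWeight]
  · rw [ENNReal.tsum_eq_iSup_sum]
    refine iSup_le fun T => ?_
    set T' := T.filter (· ∈ S)
    have hud : InformationTheory.UniquelyDecodable (T' : Set (List Bool)) :=
      uniquelyDecodable_of_prefixFree (by simp [T', h0]) fun π hπ ρ hρ =>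
        hS π (by simpa [T'] using And.right (by simpa [T'] using hπ))
          ρ (by simpa [T'] using And.right (by simpa [T'] using hρ))
    have hk := InformationTheory.kraft_mcmillan_inequality hud
    calc ∑ π ∈ T, S.indicator programWeight π = ∑ π ∈ T', programWeight π := by
          rw [Finset.sum_filter]; exact Finset.sum_congr rfl fun π _ => Set.indicator_apply _ _ _
      _ = ENNReal.ofReal (∑ π ∈ T', (1 / 2) ^ π.length) := by
          rw [ENNReal.ofReal_sum_of_nonneg fun π _ => by positivity]
          exact Finset.sum_congr rfl fun π _ => programWeight_eq_ofReal π
      _ ≤ 1 := by simpa using hk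

theorem tsum_iSup_eq_of_monotone {α : Type*} (a : ℕ → α → ℝ≥0∞) (ha : Monotone a) :
    ∑' x, ⨆ t, a t x = ⨆ t, ∑' x, a t x := by
  simp only [ENNReal.tsum_eq_iSup_sum]
  rw [iSup_comm]
  refine iSup_congr fun T => ?_
  exact ENNReal.finsetSum_iSup_of_monotone fun x s t hst => ha hst x

theorem tendsto_tsum_indicator_iUnion {α : Type*} (w : α → ℝ≥0∞) {S : ℕ → Set α}
    (hS : Monotone S) : Tendsto (fun t => ∑' x, (S t).indicator w x) atTop
      (𝓝 (∑' x, (⋃ t, S t).indicator w x)) := by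
  have hmono : Monotone fun t => (S t).indicator w := fun s t hst =>
    Set.indicator_le_indicator_of_subset (hS hst) fun _ => zero_le
  have : ∑' x, (⋃ t, S t).indicator w x = ⨆ t, ∑' x, (S t).indicator w x := by
    rw [← tsum_iSup_eq_of_monotone _ hmono]
    refine tsum_congr fun x => ?_
    rw [Set.indicator_iUnion_apply (by rfl)]
  rw [this]
  exact tendsto_atTop_iSup fun s t hst => ENNReal.tsum_le_tsum (hmono hst)

/-! ### Strongly finite outer measures -/

variable {n : ℕ}

/-- An outer measure need not be additive even on disjoint sets of rational points. Countable
subadditivity gives this inequality, which replaces additivity in the counting of cubes. -/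
theorem StronglyFinite.le_tsum {μ : OuterMeasure (EuclideanSpace ℝ (Fin n))}
    (hμ : StronglyFinite μ) (E : Set (EuclideanSpace ℝ (Fin n))) :
    μ E ≤ ∑' q : Fin n → ℚ, (ratPoint ⁻¹' E).indicator (fun q => μ {ratPoint q}) q := by
  have hE : E ⊆ (Set.range (ratPoint (n := n)))ᶜ ∪
      ⋃ q : ↥(ratPoint (n := n) ⁻¹' E), {ratPoint (q : Fin n → ℚ)} := by
    intro x hx
    by_cases h : x ∈ Set.range (ratPoint (n := n))
    · obtain ⟨q, rfl⟩ := h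
      exact Or.inr (Set.mem_iUnion.2 ⟨⟨q, hx⟩, rfl⟩)
    · exact Or.inl h
  calc μ E ≤ μ (Set.range (ratPoint (n := n)))ᶜ +
        μ (⋃ q : ↥(ratPoint (n := n) ⁻¹' E), {ratPoint (q : Fin n → ℚ)}) :=
        (measure_mono hE).trans (measure_union_le _ _)
    _ ≤ 0 + ∑' q : ↥(ratPoint (n := n) ⁻¹' E), μ {ratPoint (q : Fin n → ℚ)} :=
        add_le_add hμ.1.le (measure_iUnion_le _)
    _ = _ := by rw [zero_add, tsum_subtype _ fun q => μ {ratPoint q}]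

theorem StronglyFinite.finitelySupported {μ : OuterMeasure (EuclideanSpace ℝ (Fin n))}
    (hμ : StronglyFinite μ) : FinitelySupported μ := by
  intro ε hε
  have h := ENNReal.tendsto_tsum_compl_atTop_zero hμ.2.ne
  obtain ⟨A, hA⟩ := ((tendsto_order.1 h).2 ε hε).exists
  refine ⟨A, lt_of_le_of_lt (hμ.le_tsum _) (lt_of_le_of_lt (le_of_eq ?_) hA)⟩
  rw [← tsum_subtype (s := ratPoint (n := n) ⁻¹' _) fun q => μ {ratPoint q}]
  have : ratPoint (n := n) ⁻¹' (ratPoint '' (A : Set (Fin n → ℚ)))ᶜ = {q | q ∉ A} := by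
    ext q
    simp [ratPoint_injective.eq_iff]
  rw [this]
  rfl

/-! ### The outer measure of the programs of a prefix machine -/

/-- The outer measure with mass `2^{-|π|}` at the rational point computed by the program `π`. -/
def programMeasure (U : List Bool →. List Bool) (n : ℕ) :
    OuterMeasure (EuclideanSpace ℝ (Fin n)) where
  measureOf E := ∑' π, {π | ∃ q : Fin n → ℚ, pointString q ∈ U π ∧ ratPoint q ∈ E}.indicator
    programWeight π
  empty := by simp
  mono h := ENNReal.tsum_le_tsum fun π => Set.indicator_le_indicator_of_subset
    (by rintro π ⟨q, hq, hE⟩; exact ⟨q, hq, h hE⟩) (fun _ => zero_le) π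
  iUnion_nat s _ := by
    rw [ENNReal.tsum_comm]
    refine ENNReal.tsum_le_tsum fun π => ?_
    -- Subadditivity holds program by program: the output of `π` lies in some `s i`, and that single
    -- term already pays for it.
    by_cases h : ∃ q : Fin n → ℚ, pointString q ∈ U π ∧ ratPoint q ∈ ⋃ i, s i
    · obtain ⟨q, hq, hE⟩ := h
      obtain ⟨i, hi⟩ := Set.mem_iUnion.1 hE
      refine le_trans ?_ (ENNReal.le_tsum i)
      rw [Set.indicator_of_mem (show π ∈ {π | ∃ q : Fin n → ℚ, pointString q ∈ U π ∧
        ratPoint q ∈ s i} from ⟨q, hq, hi⟩)]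
      exact Set.indicator_le_self _ _ _
    · rw [Set.indicator_of_notMem (by exact h)]
      exact zero_le

theorem programMeasure_apply (U : List Bool →. List Bool)
    (E : Set (EuclideanSpace ℝ (Fin n))) : programMeasure U n E =
      ∑' π, {π | ∃ q : Fin n → ℚ, pointString q ∈ U π ∧ ratPoint q ∈ E}.indicator
        programWeight π := rfl

theorem programWeight_le_programMeasure {U : List Bool →. List Bool} {π : List Bool}
    {q : Fin n → ℚ} (hq : pointString q ∈ U π) {E : Set (EuclideanSpace ℝ (Fin n))}
    (hE : ratPoint q ∈ E) : programWeight π ≤ programMeasure U n E := by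
  rw [programMeasure_apply]
  refine le_trans ?_ (ENNReal.le_tsum π)
  rw [Set.indicator_of_mem]
  exact ⟨q, hq, hE⟩

theorem programMeasure_stronglyFinite {U : List Bool →. List Bool} (hU : IsPrefixMachine U) :
    StronglyFinite (programMeasure U n) := by
  constructor
  · rw [programMeasure_apply, ENNReal.tsum_eq_zero]
    intro π
    refine Set.indicator_of_notMem ?_ _
    rintro ⟨q, -, hq⟩
    exact hq ⟨q, rfl⟩
  · refine lt_of_le_of_lt ?_ (lt_of_le_of_lt (tsum_programWeight_le_one (S := {π | (U π).Dom})
      fun π hπ ρ hρ => hU.prefixFree π ρ hπ hρ) ENNReal.one_lt_top)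
    simp only [programMeasure_apply]
    rw [ENNReal.tsum_comm]
    refine ENNReal.tsum_le_tsum fun π => ?_
    -- After exchanging the sums, a program contributes to at most one point, so the total mass is
    -- bounded by the Kraft sum.
    by_cases h : ∃ q : Fin n → ℚ, pointString q ∈ U π
    · obtain ⟨q, hq⟩ := h
      rw [tsum_eq_single q, Set.indicator_of_mem (show π ∈ {π | (U π).Dom} from Part.dom_iff_mem.2
        ⟨_, hq⟩)]
      · exact Set.indicator_le_self _ _ _
      · intro q' hq'
        refine Set.indicator_of_notMem ?_ _
        rintro ⟨p, hp, hpq⟩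
        rw [Set.mem_singleton_iff, ratPoint_injective.eq_iff] at hpq
        exact hq' (hpq ▸ pointString_injective (Part.mem_unique hp hq))
    · refine le_of_eq_of_le ?_ zero_le
      rw [ENNReal.tsum_eq_zero]
      intro q
      refine Set.indicator_of_notMem ?_ _
      rintro ⟨p, hp, -⟩
      exact h ⟨p, hp⟩

open Nat.Partrec (Code)

/-! ### Lower semicomputability of the program measure -/

theorem exists_code_of_partrec {U : List Bool →. List Bool} (hU : Partrec U) :
    ∃ c : Code, ∀ π w : List Bool,
      w ∈ U π ↔ ∃ t, Encodable.encode w ∈ Code.evaln t c (Encodable.encode π) := by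
  obtain ⟨c, hc⟩ := Code.exists_code.1 hU
  refine ⟨c, fun π w => ?_⟩
  rw [← Code.evaln_complete, hc]
  simp

/-- The programs of length at most `t` for which `c` computes within `t` steps the code of an
element of the list `L`. -/
def stagePrograms (c : Code) (L : List (Fin n → ℤ × ℕ)) (t : ℕ) : Set (List Bool) :=
  {π | π.length ≤ t ∧
    ∃ p ∈ L, Code.evaln t c (Encodable.encode π) = some (Encodable.encode (binaryString p))}

open Classical in
/-- The total weight of the stage `t` programs, as a multiple of `2^{-t}`. -/
def stageNumerator (c : Code) (L : List (Fin n → ℤ × ℕ)) (t : ℕ) : ℕ :=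
  ((List.range t).map fun i => ((Encodable.decode₂ (List Bool) i).map fun π =>
    if π ∈ stagePrograms c L t then 2 ^ (t - π.length) else 0).getD 0).sum

theorem primrec_list_sum : Primrec (List.sum : List ℕ → ℕ) :=
  (Primrec.list_foldr Primrec.id (Primrec.const 0)
    (h := fun _ p => p.1 + p.2) (Primrec.nat_add.comp (Primrec.fst.comp Primrec.snd)
      (Primrec.snd.comp Primrec.snd))).of_eq fun l => by
        induction l with
        | nil => rfl
        | cons a l ih => simpa using ih

theorem primrecPred_stagePrograms (c : Code) :
    PrimrecPred fun a : (List (Fin n → ℤ × ℕ) × ℕ) × List Bool =>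
      a.2 ∈ stagePrograms c a.1.1 a.1.2 := by
  refine PrimrecPred.and (Primrec.nat_le.comp (Primrec.list_length.comp Primrec.snd)
    (Primrec.snd.comp Primrec.fst)) ?_
  have hR : PrimrecRel fun (p : Fin n → ℤ × ℕ) (a : (List (Fin n → ℤ × ℕ) × ℕ) × List Bool) =>
      Code.evaln a.1.2 c (Encodable.encode a.2) = some (Encodable.encode (binaryString p)) := by
    refine Primrec.eq.comp ?_ (Primrec.option_some.comp
      (Primrec.encode.comp (primrec_binaryString.comp Primrec.fst)))
    exact Code.primrec_evaln.comp (Primrec.pair (Primrec.pair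
      (Primrec.snd.comp (Primrec.fst.comp Primrec.snd)) (Primrec.const c))
      (Primrec.encode.comp (Primrec.snd.comp Primrec.snd)))
  exact hR.exists_mem_list.comp (Primrec.fst.comp Primrec.fst) Primrec.id

theorem primrec_stageNumerator (c : Code) :
    Primrec₂ (stageNumerator (n := n) c) := by
  classical
  refine primrec_list_sum.comp (Primrec.list_map (Primrec.list_range.comp Primrec.snd) ?_)
  refine Primrec.option_getD.comp (Primrec.option_map (Primrec.decode₂.comp Primrec.snd) ?_)
    (Primrec.const 0)
  refine Primrec.ite ((primrecPred_stagePrograms c).comp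
    (Primrec.pair (Primrec.fst.comp Primrec.fst) Primrec.snd)) ?_ (Primrec.const 0)
  exact primrec_nat_pow.comp (Primrec.const 2) (Primrec.nat_sub.comp
    (Primrec.snd.comp (Primrec.fst.comp Primrec.fst)) (Primrec.list_length.comp Primrec.snd))

theorem stageNumerator_congr (c : Code) {L L' : List (Fin n → ℤ × ℕ)}
    (h : ∀ p, p ∈ L ↔ p ∈ L') (t : ℕ) : stageNumerator c L t = stageNumerator c L' t := by
  have : stagePrograms c L t = stagePrograms c L' t := by simp only [stagePrograms, h]
  unfold stageNumerator
  rw [this]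

/-- Evaluation with bound `t` fails on inputs numbered `t` or more. Hence the finite sum over `i <
t` in `stageNumerator` misses no stage `t` program. -/
theorem encode_lt_of_mem_stagePrograms {c : Code} {L : List (Fin n → ℤ × ℕ)} {t : ℕ}
    {π : List Bool} (h : π ∈ stagePrograms c L t) : Encodable.encode π < t := by
  obtain ⟨-, p, -, hp⟩ := h
  exact Code.evaln_bound (Option.mem_def.2 hp)

/-- Restricting to programs of length at most `t` makes each weight an integer multiple of `2^{-t}`.
The partial inverse `decode₂` ensures that each program is counted once. -/
theorem stageNumerator_div (c : Code) (L : List (Fin n → ℤ × ℕ)) (t : ℕ) :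
    (stageNumerator c L t : ℝ≥0∞) / 2 ^ t =
      ∑' π, (stagePrograms c L t).indicator programWeight π := by
  classical
  set h : ℕ → ℝ≥0∞ := fun i => ((Encodable.decode₂ (List Bool) i).map fun π =>
    (stagePrograms c L t).indicator programWeight π).getD 0 with hh
  have h1 : ∑' π, (stagePrograms c L t).indicator programWeight π = ∑' i, h i := by
    rw [← Function.Injective.tsum_eq (Encodable.encode_injective (α := List Bool))]
    · simp [hh]
    · intro i hi
      cases hd : Encodable.decode₂ (List Bool) i with
      | none => simp [hh, hd] at hi
      | some π => exact ⟨π, Encodable.mem_decode₂.1 hd⟩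
  have h2 : ∑' i, h i = ∑ i ∈ Finset.range t, h i := by
    refine tsum_eq_sum fun i hi => ?_
    cases hd : Encodable.decode₂ (List Bool) i with
    | none => simp [hh, hd]
    | some π =>
      have he : Encodable.encode π = i := Encodable.mem_decode₂.1 hd
      simp only [hh, hd, Option.map_some, Option.getD_some]
      refine Set.indicator_of_notMem (fun hm => hi ?_) _
      exact Finset.mem_range.2 (he ▸ encode_lt_of_mem_stagePrograms hm)
  have h3 : ∀ g : ℕ → ℕ, ((List.range t).map g).sum = ∑ i ∈ Finset.range t, g i := fun g => rfl
  rw [h1, h2, stageNumerator, h3, Nat.cast_sum, ENNReal.div_eq_inv_mul, Finset.mul_sum]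
  refine Finset.sum_congr rfl fun i _ => ?_
  cases hd : Encodable.decode₂ (List Bool) i with
  | none => simp [hh, hd]
  | some π =>
    simp only [hh, hd, Option.map_some, Option.getD_some]
    by_cases hm : π ∈ stagePrograms c L t
    · rw [Set.indicator_of_mem hm, if_pos hm, programWeight]
      obtain ⟨k, hk⟩ := Nat.exists_eq_add_of_le hm.1
      rw [hk, Nat.add_sub_cancel_left, pow_add, ENNReal.mul_inv (by simp) (by simp),
        ENNReal.inv_pow]
      push_cast
      rw [mul_assoc, ENNReal.inv_mul_cancel (by simp) (by simp), mul_one]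
    · rw [Set.indicator_of_notMem hm, if_neg hm]
      simp

theorem monotone_stagePrograms (c : Code) (L : List (Fin n → ℤ × ℕ)) :
    Monotone (stagePrograms c L) := by
  rintro s t hst π ⟨hl, p, hp, he⟩
  exact ⟨hl.trans hst, p, hp, Option.mem_def.1 (Code.evaln_mono hst (Option.mem_def.2 he))⟩

theorem programMeasure_lowerSemicomputable {U : List Bool →. List Bool} (hU : IsPrefixMachine U) :
    LowerSemicomputable (programMeasure U n) := by
  refine ⟨(programMeasure_stronglyFinite hU).finitelySupported, ?_⟩
  obtain ⟨c, hc⟩ := exists_code_of_partrec hU.partrec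
  -- The order chosen by `toList` is harmless: by `stageNumerator_congr` the value depends only on
  -- which codes occur in the list.
  set f : Finset (Fin n → ℚ) → ℕ → ℚ≥0 := fun A t =>
    (stageNumerator c (A.toList.map pointCode) t : ℚ≥0) / 2 ^ t with hf
  have hfS : ∀ A t, ((f A t : ℝ≥0) : ℝ≥0∞) =
      ∑' π, (stagePrograms c (A.toList.map pointCode) t).indicator programWeight π := by
    intro A t
    rw [← stageNumerator_div]
    simp only [hf]
    rw [NNRat.cast_div, ENNReal.coe_div (by simp)]
    simp
  have hUn : ∀ A : Finset (Fin n → ℚ), ⋃ t, stagePrograms c (A.toList.map pointCode) t =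
      {π | ∃ q : Fin n → ℚ, pointString q ∈ U π ∧ ratPoint q ∈ ratPoint '' (A : Set (Fin n → ℚ))} := by
    intro A
    ext π
    simp only [Set.mem_iUnion, Set.mem_ofPred_eq]
    constructor
    · rintro ⟨t, -, p, hp, he⟩
      obtain ⟨q, hq, rfl⟩ := List.mem_map.1 hp
      exact ⟨q, (hc _ _).2 ⟨t, he⟩, q, by simpa using hq, rfl⟩
    · rintro ⟨q, hq, q', hq', hqq⟩
      obtain rfl := ratPoint_injective hqq
      obtain ⟨t, ht⟩ := (hc _ _).1 hq
      refine ⟨max t π.length, le_max_right _ _, pointCode q', List.mem_map.2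
        ⟨q', by simpa using hq', rfl⟩, ?_⟩
      exact Code.evaln_mono (le_max_left _ _) ht
  have hmono := fun A : Finset (Fin n → ℚ) => monotone_stagePrograms c (A.toList.map pointCode)
  refine ⟨f, ⟨fun L t => ratCode (mkRat (stageNumerator c L t) (2 ^ t)), ?_, fun l t => ?_⟩, ?_, ?_⟩
  · exact (primrec_ratCode_mkRat.comp
      (primrec_int_natCast.comp (primrec_stageNumerator c))
      (primrec_nat_pow.comp (Primrec.const 2) Primrec.snd)).to_comp
  · beta_reduce
    congr 1
    rw [Rat.mkRat_eq_div, stageNumerator_congr c (L' := l.toFinset.toList.map pointCode)]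
    · simp [hf]
    · simp
  · intro A s t hst
    constructor
    · have : ((f A s : ℝ≥0) : ℝ≥0∞) ≤ ((f A t : ℝ≥0) : ℝ≥0∞) := by
        rw [hfS, hfS]
        exact ENNReal.tsum_le_tsum fun π => Set.indicator_le_indicator_of_subset (hmono A hst)
          (fun _ => zero_le) π
      exact_mod_cast this
    · rw [hfS, programMeasure_apply, ← hUn]
      exact ENNReal.tsum_le_tsum fun π => Set.indicator_le_indicator_of_subset
        (Set.subset_iUnion _ t) (fun _ => zero_le) π
  · intro A
    simp only [hfS]
    rw [programMeasure_apply, ← hUn]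
    exact tendsto_tsum_indicator_iUnion _ (hmono A)

/-! ### Enumeration without repetitions -/

/-- The distinct values among the first terms of a sequence of optional values, in the order of
their first appearance. -/
def distinctOutputs {α : Type*} [DecidableEq α] (g : ℕ → Option α) (e : ℕ) : List α :=
  Nat.rec [] (fun k l => Option.casesOn (g k) l fun a => if a ∈ l then l else l ++ [a]) e

section distinctOutputs

variable {α : Type*} [DecidableEq α] (g : ℕ → Option α)

theorem distinctOutputs_succ_of_none {e : ℕ} (h : g e = none) :
    distinctOutputs g (e + 1) = distinctOutputs g e := by
  simp [distinctOutputs, h]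

theorem distinctOutputs_succ_of_some {e : ℕ} {a : α} (h : g e = some a) :
    distinctOutputs g (e + 1) =
      if a ∈ distinctOutputs g e then distinctOutputs g e else distinctOutputs g e ++ [a] := by
  have hs : distinctOutputs g (e + 1) = Option.casesOn (motive := fun _ => List α) (g e)
      (distinctOutputs g e) fun a => if a ∈ distinctOutputs g e then distinctOutputs g e
        else distinctOutputs g e ++ [a] := rfl
  rw [hs, h]

theorem distinctOutputs_prefix_succ (e : ℕ) :
    distinctOutputs g e <+: distinctOutputs g (e + 1) := by
  cases h : g e with
  | none => rw [distinctOutputs_succ_of_none g h]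
  | some a =>
    rw [distinctOutputs_succ_of_some g h]
    split_ifs
    · exact List.prefix_rfl
    · exact List.prefix_append _ _

theorem distinctOutputs_prefix {e e' : ℕ} (h : e ≤ e') :
    distinctOutputs g e <+: distinctOutputs g e' := by
  induction e', h using Nat.le_induction with
  | base => exact List.prefix_rfl
  | succ k _ ih => exact ih.trans (distinctOutputs_prefix_succ g k)

theorem nodup_distinctOutputs (e : ℕ) : (distinctOutputs g e).Nodup := by
  induction e with
  | zero => exact List.nodup_nil
  | succ e ih =>
    cases h : g e with
    | none => rwa [distinctOutputs_succ_of_none g h]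
    | some a =>
      rw [distinctOutputs_succ_of_some g h]
      split_ifs with ha
      · exact ih
      · rw [List.nodup_append]
        refine ⟨ih, List.nodup_singleton a, fun b hb c hc => ?_⟩
        rw [List.mem_singleton] at hc
        rintro rfl
        exact ha (hc ▸ hb)

theorem exists_of_mem_distinctOutputs {e : ℕ} {a : α} (ha : a ∈ distinctOutputs g e) :
    ∃ k, g k = some a := by
  induction e with
  | zero => exact absurd ha List.not_mem_nil
  | succ e ih =>
    cases h : g e with
    | none => exact ih (by rwa [distinctOutputs_succ_of_none g h] at ha)
    | some b =>
      rw [distinctOutputs_succ_of_some g h] at ha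
      split_ifs at ha with hb
      · exact ih ha
      · rcases List.mem_append.1 ha with ha | ha
        · exact ih ha
        · exact ⟨e, by rw [h, List.mem_singleton.1 ha]⟩

theorem mem_distinctOutputs_succ {e : ℕ} {a : α} (h : g e = some a) :
    a ∈ distinctOutputs g (e + 1) := by
  rw [distinctOutputs_succ_of_some g h]
  split_ifs with ha
  · exact ha
  · simp

/-- The lists grow only at the end, so the entry at an index, once present, never changes. An index
thus names an element independently of the stage. -/
theorem getElem?_distinctOutputs_unique {e e' i : ℕ} {a b : α}
    (ha : (distinctOutputs g e)[i]? = some a) (hb : (distinctOutputs g e')[i]? = some b) :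
    a = b := by
  have key : ∀ {e e' : ℕ} {a b : α}, e ≤ e' → (distinctOutputs g e)[i]? = some a →
      (distinctOutputs g e')[i]? = some b → a = b := by
    intro e e' a b hle ha hb
    obtain ⟨t, ht⟩ := distinctOutputs_prefix g hle
    have hi : i < (distinctOutputs g e).length := (List.getElem?_eq_some_iff.1 ha).1
    rw [← ht, List.getElem?_append_left hi, ha] at hb
    exact Option.some.inj hb
  rcases le_total e e' with h | h
  · exact key h ha hb
  · exact (key h hb ha).symm

theorem computable_distinctOutputs {α β : Type*} [DecidableEq α] [Primcodable α] [Primcodable β]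
    {g : β → ℕ → Option α} (hg : Computable₂ g) :
    Computable₂ fun b e => distinctOutputs (g b) e := by
  have hmem : PrimrecRel fun (a : α) (l : List α) => a ∈ l := by
    refine PrimrecRel.of_eq (PrimrecRel.swap ((Primrec.eq (α := α)).exists_mem_list)) fun a l => ?_
    simp [Function.swap]
  have hins : Primrec₂ fun (l : List α) (a : α) => if a ∈ l then l else l ++ [a] :=
    Primrec.ite (hmem.comp Primrec.snd Primrec.fst) Primrec.fst Primrec.list_concat
  refine Computable.nat_rec (f := fun p : β × ℕ => p.2) (g := fun _ => ([] : List α))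
    (h := fun p q => Option.casesOn (g p.1 q.1) q.2 fun a => if a ∈ q.2 then q.2 else q.2 ++ [a])
    Computable.snd (Computable.const []) ?_
  refine Computable.option_casesOn (hg.comp (Computable.fst.comp Computable.fst)
    (Computable.fst.comp Computable.snd)) (Computable.snd.comp Computable.snd) ?_
  exact hins.to_comp.comp (Computable.snd.comp (Computable.snd.comp Computable.fst)) Computable.snd

end distinctOutputs

/-! ### Self-delimiting codes -/

/-- A self-delimiting description of `(r, s)` followed by `i` written with `s + w` binary digits. -/
def blockCode (w : ℕ) (p : ℕ × ℕ) (i : ℕ) : List Bool :=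
  List.replicate (Nat.pair p.1 p.2).bits.length true ++ false :: ((Nat.pair p.1 p.2).bits ++
    (i.bits ++ List.replicate (p.2 + w - i.bits.length) false))

theorem length_blockCode {w : ℕ} {p : ℕ × ℕ} {i : ℕ} (hi : i < 2 ^ (p.2 + w)) :
    (blockCode w p i).length = p.2 + w + 2 * (Nat.pair p.1 p.2).size + 1 := by
  have : i.size ≤ p.2 + w := Nat.size_le.2 hi
  simp only [blockCode, List.length_append, List.length_replicate, List.length_cons,
    Nat.size_eq_bits_len]
  omega

theorem primrec_blockCode (w : ℕ) : Primrec₂ (blockCode w) := by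
  have hh : Primrec fun a : (ℕ × ℕ) × ℕ => (Nat.pair a.1.1 a.1.2).bits :=
    primrec_nat_bits.comp (Primrec₂.natPair.comp (Primrec.fst.comp Primrec.fst)
      (Primrec.snd.comp Primrec.fst))
  have hi : Primrec fun a : (ℕ × ℕ) × ℕ => a.2.bits := primrec_nat_bits.comp Primrec.snd
  refine Primrec.list_append.comp
    ((primrec_list_replicate true).comp (Primrec.list_length.comp hh))
    (Primrec.list_cons.comp (Primrec.const false) (Primrec.list_append.comp hh
      (Primrec.list_append.comp hi ((primrec_list_replicate false).comp ?_))))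
  exact Primrec.nat_sub.comp (Primrec.nat_add.comp (Primrec.snd.comp Primrec.fst)
    (Primrec.const w)) (Primrec.list_length.comp hi)

theorem replicate_true_prefix {a b : ℕ} {X Y : List Bool}
    (h : List.replicate a true ++ false :: X <+: List.replicate b true ++ false :: Y) :
    a = b ∧ X <+: Y := by
  induction a generalizing b with
  | zero =>
    cases b with
    | zero => simpa using h
    | succ b => simp [List.replicate_succ] at h
  | succ a ih =>
    cases b with
    | zero => simp [List.replicate_succ] at h
    | succ b =>
      simp only [List.replicate_succ, List.cons_append, List.cons_prefix_cons, true_and] at h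
      exact ⟨by rw [(ih h).1], (ih h).2⟩

/-- The unary prefix fixes the length of the header, and the header fixes `(r, s)`. Only the index
parts can then differ. -/
theorem blockCode_prefix {w : ℕ} {p p' : ℕ × ℕ} {i i' : ℕ}
    (h : blockCode w p i <+: blockCode w p' i') : p = p' ∧
      i.bits ++ List.replicate (p.2 + w - i.bits.length) false <+:
        i'.bits ++ List.replicate (p'.2 + w - i'.bits.length) false := by
  obtain ⟨hl, hp⟩ := replicate_true_prefix h
  have hb : (Nat.pair p.1 p.2).bits = (Nat.pair p'.1 p'.2).bits := by
    have h1 := (List.prefix_append _ _).trans hp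
    have h2 := List.prefix_append (Nat.pair p'.1 p'.2).bits
      (i'.bits ++ List.replicate (p'.2 + w - i'.bits.length) false)
    exact (List.prefix_of_prefix_length_le h1 h2 hl.le).eq_of_length hl
  have hpp : p = p' := by
    have := congrArg Nat.unpair (bits_injective hb)
    simpa [Prod.ext_iff] using this
  subst hpp
  exact ⟨rfl, (List.prefix_append_right_inj _).1 hp⟩

theorem blockCode_injective {w : ℕ} {p p' : ℕ × ℕ} {i i' : ℕ}
    (h : blockCode w p i = blockCode w p' i') : p = p' ∧ i = i' := by
  obtain ⟨hp, h1⟩ := blockCode_prefix (h ▸ List.prefix_rfl : blockCode w p i <+: blockCode w p' i')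
  obtain ⟨-, h2⟩ := blockCode_prefix (h ▸ List.prefix_rfl : blockCode w p' i' <+: blockCode w p i)
  have := congrArg bitsValue (h1.eq_of_length_le h2.length_le)
  rw [bitsValue_append_replicate_false, bitsValue_append_replicate_false, bitsValue_bits,
    bitsValue_bits] at this
  exact ⟨hp, this⟩

/-- If, uniformly in `(r, s)`, a family of at most `2^{s+w}` strings is computably enumerable, then
some prefix machine computes each member of the family from a program of length
`s + w + O(log (r + s))`. -/
theorem exists_prefixMachine_of_enumeration {g : ℕ × ℕ → ℕ → Option (List Bool)}
    (hg : Computable₂ g) (w : ℕ)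
    (hcard : ∀ (p : ℕ × ℕ) (l : List (List Bool)), l.Nodup →
      (∀ a ∈ l, ∃ e, g p e = some a) → l.length ≤ 2 ^ (p.2 + w)) :
    ∃ M : List Bool →. List Bool, IsPrefixMachine M ∧ ∀ (p : ℕ × ℕ) (e : ℕ) (a : List Bool),
      g p e = some a → ∃ π : List Bool,
        π.length = p.2 + w + 2 * (Nat.pair p.1 p.2).size + 1 ∧ a ∈ M π := by
  -- The machine searches over `k` for a parse of its program as `blockCode w p i` together with a
  -- stage `e` at which the `i`-th distinct output exists. The bound on `i` gives all accepted
  -- programs with the same `p` the same length.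
  set h : List Bool → ℕ → Option (List Bool) := fun π k =>
    (Encodable.decode (α := (ℕ × ℕ) × ℕ × ℕ) k).bind fun a =>
      if π = blockCode w a.1 a.2.1 ∧ a.2.1 < 2 ^ (a.1.2 + w) then
        (distinctOutputs (g a.1) a.2.2)[a.2.1]? else none with hh
  have hspec : ∀ {π : List Bool} {k : ℕ} {v : List Bool}, h π k = some v → ∃ p i e,
      π = blockCode w p i ∧ i < 2 ^ (p.2 + w) ∧ (distinctOutputs (g p) e)[i]? = some v := by
    intro π k v hk
    simp only [hh, Option.bind_eq_some_iff] at hk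
    obtain ⟨⟨p, i, e⟩, -, hk⟩ := hk
    split_ifs at hk with hc
    exact ⟨p, i, e, hc.1, hc.2, hk⟩
  have hcomp : Computable₂ h := by
    refine Computable.option_bind (Computable.decode.comp Computable.snd) ?_
    have hp : PrimrecPred fun b : (List Bool × ℕ) × (ℕ × ℕ) × ℕ × ℕ =>
        b.1.1 = blockCode w b.2.1 b.2.2.1 ∧ b.2.2.1 < 2 ^ (b.2.1.2 + w) := by
      have hi : Primrec fun b : (List Bool × ℕ) × (ℕ × ℕ) × ℕ × ℕ => b.2.2.1 :=
        Primrec.fst.comp (Primrec.snd.comp Primrec.snd)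
      have hpp : Primrec fun b : (List Bool × ℕ) × (ℕ × ℕ) × ℕ × ℕ => b.2.1 :=
        Primrec.fst.comp Primrec.snd
      exact PrimrecPred.and (Primrec.eq.comp (Primrec.fst.comp Primrec.fst)
        ((primrec_blockCode w).comp hpp hi)) (Primrec.nat_lt.comp hi (primrec_nat_pow.comp
          (Primrec.const 2) (Primrec.nat_add.comp (Primrec.snd.comp hpp) (Primrec.const w))))
    have hD : Computable fun b : (List Bool × ℕ) × (ℕ × ℕ) × ℕ × ℕ =>
        (distinctOutputs (g b.2.1) b.2.2.2)[b.2.2.1]? :=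
      Computable.list_getElem?.comp ((computable_distinctOutputs hg).comp
        (Computable.fst.comp Computable.snd)
        (Computable.snd.comp (Computable.snd.comp Computable.snd)))
        (Computable.fst.comp (Computable.snd.comp Computable.snd))
    refine (Computable.cond hp.decide.to_comp hD (Computable.const none)).of_eq fun b => ?_
    rw [Bool.cond_decide]
  refine ⟨fun π => Nat.rfindOpt (h π), ⟨Partrec.rfindOpt hcomp, ?_⟩, ?_⟩
  · intro π ρ hπ hρ hpre
    obtain ⟨k, v, hk⟩ := Nat.rfindOpt_dom.1 hπ
    obtain ⟨k', v', hk'⟩ := Nat.rfindOpt_dom.1 hρ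
    obtain ⟨p, i, e, rfl, hi, -⟩ := hspec hk
    obtain ⟨p', i', e', rfl, hi', -⟩ := hspec hk'
    -- Comparable programs share `(r, s)`, hence have equal length, hence coincide.
    refine hpre.eq_of_length ?_
    obtain rfl := (blockCode_prefix hpre).1
    rw [length_blockCode hi, length_blockCode hi']
  · intro p e a ha
    obtain ⟨i, hi⟩ := List.mem_iff_getElem?.1 (mem_distinctOutputs_succ (g p) ha)
    have hil : i < 2 ^ (p.2 + w) := (List.getElem?_eq_some_iff.1 hi).1.trans_le
      (hcard p _ (nodup_distinctOutputs (g p) (e + 1)) fun b hb =>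
        exists_of_mem_distinctOutputs (g p) hb)
    refine ⟨blockCode w p i, length_blockCode hil, ?_⟩
    have hdom : (Nat.rfindOpt (h (blockCode w p i))).Dom := by
      refine Nat.rfindOpt_dom.2 ⟨Encodable.encode (p, i, e + 1), a, ?_⟩
      simpa only [hh, Encodable.encodek, Option.bind_some, hil, and_self, if_true, Option.mem_def] using hi
    -- The search may halt at a stage other than the one exhibited; stability of the entries forces
    -- the same output.
    obtain ⟨v, hv⟩ := Part.dom_iff_mem.1 hdom
    obtain ⟨k, hk⟩ := Nat.rfindOpt_spec hv
    obtain ⟨p', i', e', heq, -, hv'⟩ := hspec hk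
    obtain ⟨rfl, rfl⟩ := blockCode_injective heq
    rwa [getElem?_distinctOutputs_unique (g p) hi hv']

/-! ### Dyadic cubes -/

theorem mem_dyadicCube_iff_floor {r : ℕ} {m : Fin n → ℤ} {x : EuclideanSpace ℝ (Fin n)} :
    x ∈ dyadicCube r m ↔ ∀ i, ⌊x i * 2 ^ r⌋ = m i := by
  refine forall_congr' fun i => ?_
  rw [Int.floor_eq_iff, div_le_iff₀ (by positivity), lt_div_iff₀ (by positivity)]

/-- Cubes of one level are disjoint, so each rational point is charged only to the cube given by the
floors of its scaled coordinates. -/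
theorem sum_dyadicCube_le {μ : OuterMeasure (EuclideanSpace ℝ (Fin n))} (hμ : StronglyFinite μ)
    (r : ℕ) (T : Finset (Fin n → ℤ)) :
    ∑ m ∈ T, μ (dyadicCube r m) ≤ ∑' q : Fin n → ℚ, μ {ratPoint q} := by
  classical
  refine (Finset.sum_le_sum fun m _ => hμ.le_tsum (dyadicCube r m)).trans ?_
  rw [← Summable.tsum_finsetSum fun m _ => ENNReal.summable]
  refine ENNReal.tsum_le_tsum fun q => ?_
  set m₀ : Fin n → ℤ := fun i => ⌊ratPoint q i * 2 ^ r⌋ with hm₀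
  have hzero : ∀ m, m ≠ m₀ →
      (ratPoint ⁻¹' dyadicCube r m).indicator (fun q => μ {ratPoint q}) q = 0 := by
    intro m hm
    refine Set.indicator_of_notMem (fun hq => hm ?_) _
    funext i
    exact (mem_dyadicCube_iff_floor.1 hq i).symm
  calc ∑ m ∈ T, (ratPoint ⁻¹' dyadicCube r m).indicator (fun q => μ {ratPoint q}) q
      ≤ ∑ m ∈ {m₀}, (ratPoint ⁻¹' dyadicCube r m).indicator (fun q => μ {ratPoint q}) q := by
        refine Finset.sum_le_sum_of_ne_zero fun m _ hne => ?_
        rw [Finset.mem_singleton]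
        by_contra hm
        exact hne (hzero m hm)
    _ ≤ μ {ratPoint q} := by
        rw [Finset.sum_singleton]
        exact Set.indicator_le_self _ _ _

/-- The least corner of a dyadic cube. -/
def dyadicCorner (r : ℕ) (m : Fin n → ℤ) : Fin n → ℚ := fun i => mkRat (m i) (2 ^ r)

theorem ratPoint_dyadicCorner (r : ℕ) (m : Fin n → ℤ) (i : Fin n) :
    ratPoint (dyadicCorner r m) i = (m i : ℝ) / 2 ^ r := by
  simp [ratPoint, dyadicCorner, Rat.mkRat_eq_div]

/-- The point with code `c` belongs to the dyadic cube `m` of level `r`. -/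
def CodeInCube (r : ℕ) (m : Fin n → ℤ) (c : Fin n → ℤ × ℕ) : Prop :=
  ∀ i, m i * ((c i).2 : ℤ) ≤ (c i).1 * ((2 ^ r : ℕ) : ℤ) ∧
    (c i).1 * ((2 ^ r : ℕ) : ℤ) < (m i + 1) * ((c i).2 : ℤ)

theorem codeInCube_pointCode {r : ℕ} {m : Fin n → ℤ} {q : Fin n → ℚ} :
    CodeInCube r m (pointCode q) ↔ ratPoint q ∈ dyadicCube r m := by
  refine forall_congr' fun i => ?_
  have hd : (0 : ℝ) < (q i).den := by exact_mod_cast (q i).den_pos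
  have hq : ratPoint q i = ((q i).num : ℝ) / (q i).den := by
    simp only [ratPoint]; exact Rat.cast_def _
  rw [hq, div_le_div_iff₀ (by positivity) hd, div_lt_div_iff₀ hd (by positivity)]
  simp only [pointCode, ratCode]
  constructor <;> rintro ⟨h1, h2⟩ <;> constructor <;> first | exact_mod_cast h1 | exact_mod_cast h2

theorem primrecPred_codeInCube :
    PrimrecPred fun a : (Fin n → ℤ × ℕ) × (ℕ × (Fin n → ℤ)) => CodeInCube a.2.1 a.2.2 a.1 := by
  refine primrecPred_forall_fin fun i => ?_
  have hc : Primrec fun a : (Fin n → ℤ × ℕ) × (ℕ × (Fin n → ℤ)) => a.1 i :=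
    Primrec.fin_app.comp Primrec.fst (Primrec.const i)
  have hm : Primrec fun a : (Fin n → ℤ × ℕ) × (ℕ × (Fin n → ℤ)) => a.2.2 i :=
    Primrec.fin_app.comp (Primrec.snd.comp Primrec.snd) (Primrec.const i)
  have hd := primrec_int_natCast.comp (Primrec.snd.comp hc)
  have hmid := primrec_int_mul.comp (Primrec.fst.comp hc) (primrec_int_natCast.comp
    (primrec_nat_pow.comp (Primrec.const 2) (Primrec.fst.comp
      (Primrec.snd (α := Fin n → ℤ × ℕ) (β := ℕ × (Fin n → ℤ))))))
  exact PrimrecPred.and (primrec_int_le.comp (primrec_int_mul.comp hm hd) hmid)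
    (primrec_int_lt.comp hmid (primrec_int_mul.comp (primrec_int_succ.comp hm) hd))

theorem primrec_pointString_dyadicCorner :
    Primrec₂ fun (r : ℕ) (m : Fin n → ℤ) => pointString (dyadicCorner r m) := by
  refine primrec_binaryString.comp (Primrec.fin_curry.2 ?_)
  exact primrec_ratCode_mkRat.comp
    (Primrec.fin_app.comp (Primrec.snd.comp Primrec.fst) Primrec.snd)
    (primrec_nat_pow.comp (Primrec.const 2) (Primrec.fst.comp Primrec.fst))

/-! ### Enumeration of the cubes of large measure -/

open Classical in
/-- The test whether a list of rational points and a time witness that the measure approximated by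
`F` exceeds `2^{-s}` on a dyadic cube of level `r`; the output is the corner of the cube. -/
def heavyCubeTest (F : List (Fin n → ℤ × ℕ) → ℕ → ℤ × ℕ) (p : ℕ × ℕ)
    (a : ((Fin n → ℤ) × List (Fin n → ℤ × ℕ)) × ℕ) : Option (List Bool) :=
  if (∀ c ∈ a.1.2, CodeInCube p.1 a.1.1 (pointCode (fracPoint c))) ∧
    ((F (a.1.2.map fun c => pointCode (fracPoint c)) a.2).2 : ℤ) <
      (F (a.1.2.map fun c => pointCode (fracPoint c)) a.2).1 * ((2 ^ p.2 : ℕ) : ℤ)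
  then some (pointString (dyadicCorner p.1 a.1.1)) else none

/-- The value of a partial function at the element with number `e`, if there is one. -/
def decodeBind {α σ : Type*} [Primcodable α] (f : α → Option σ) (e : ℕ) : Option σ :=
  (Encodable.decode (α := α) e).bind f

theorem computable_decodeBind {α β σ : Type*} [Primcodable α] [Primcodable β] [Primcodable σ]
    {f : β → α → Option σ} (hf : Computable₂ f) : Computable₂ fun b e => decodeBind (f b) e :=
  Computable.option_bind (Computable.decode.comp Computable.snd)
    (hf.comp (Computable.fst.comp Computable.fst) Computable.snd)

theorem exists_decodeBind_eq {α σ : Type*} [Primcodable α] (f : α → Option σ) (a : α) :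
    ∃ e, decodeBind f e = f a :=
  ⟨Encodable.encode a, by rw [decodeBind, Encodable.encodek, Option.bind_some]⟩

/-- Search for a dyadic cube of level `r` on which the measure approximated by `F` exceeds
`2^{-s}`. -/
def heavyCubeSearch (F : List (Fin n → ℤ × ℕ) → ℕ → ℤ × ℕ) (p : ℕ × ℕ) (e : ℕ) :
    Option (List Bool) :=
  decodeBind (heavyCubeTest F p) e

theorem computable_heavyCubeTest {F : List (Fin n → ℤ × ℕ) → ℕ → ℤ × ℕ} (hF : Computable₂ F) :
    Computable₂ (heavyCubeTest F) := by
  classical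
  have hL : Primrec fun b : (ℕ × ℕ) × ((Fin n → ℤ) × List (Fin n → ℤ × ℕ)) × ℕ => b.2.1.2 :=
    Primrec.snd.comp (Primrec.fst.comp Primrec.snd)
  have hm : Primrec fun b : (ℕ × ℕ) × ((Fin n → ℤ) × List (Fin n → ℤ × ℕ)) × ℕ => b.2.1.1 :=
    Primrec.fst.comp (Primrec.fst.comp Primrec.snd)
  have hr : Primrec fun b : (ℕ × ℕ) × ((Fin n → ℤ) × List (Fin n → ℤ × ℕ)) × ℕ => b.1.1 :=
    Primrec.fst.comp Primrec.fst
  have hs : Primrec fun b : (ℕ × ℕ) × ((Fin n → ℤ) × List (Fin n → ℤ × ℕ)) × ℕ => b.1.2 :=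
    Primrec.snd.comp Primrec.fst
  have hR : PrimrecRel fun (c : Fin n → ℤ × ℕ) (a : ℕ × (Fin n → ℤ)) =>
      CodeInCube a.1 a.2 (pointCode (fracPoint c)) :=
    PrimrecPred.comp primrecPred_codeInCube
      (Primrec.pair (primrec_pointCode_fracPoint.comp Primrec.fst) Primrec.snd)
  have h1 : PrimrecPred fun b : (ℕ × ℕ) × ((Fin n → ℤ) × List (Fin n → ℤ × ℕ)) × ℕ =>
      ∀ c ∈ b.2.1.2, CodeInCube b.1.1 b.2.1.1 (pointCode (fracPoint c)) :=
    hR.forall_mem_list.comp hL (Primrec.pair hr hm)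
  have hmap : Primrec fun b : (ℕ × ℕ) × ((Fin n → ℤ) × List (Fin n → ℤ × ℕ)) × ℕ =>
      b.2.1.2.map fun c => pointCode (fracPoint c) :=
    Primrec.list_map hL (primrec_pointCode_fracPoint.comp Primrec.snd)
  have hFv : Computable fun b : (ℕ × ℕ) × ((Fin n → ℤ) × List (Fin n → ℤ × ℕ)) × ℕ =>
      F (b.2.1.2.map fun c => pointCode (fracPoint c)) b.2.2 :=
    hF.comp hmap.to_comp (Computable.snd.comp Computable.snd)
  have h2 : PrimrecRel fun (v : ℤ × ℕ) (s : ℕ) => (v.2 : ℤ) < v.1 * ((2 ^ s : ℕ) : ℤ) :=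
    primrec_int_lt.comp (primrec_int_natCast.comp (Primrec.snd.comp Primrec.fst))
      (primrec_int_mul.comp (Primrec.fst.comp Primrec.fst) (primrec_int_natCast.comp
        (primrec_nat_pow.comp (Primrec.const 2) Primrec.snd)))
  have h2' := (PrimrecRel.decide h2).to_comp.comp hFv hs.to_comp
  have hout : Primrec fun b : (ℕ × ℕ) × ((Fin n → ℤ) × List (Fin n → ℤ × ℕ)) × ℕ =>
      some (pointString (dyadicCorner b.1.1 b.2.1.1)) :=
    Primrec.option_some.comp (primrec_pointString_dyadicCorner.comp hr hm)
  refine Computable.of_eq (Computable.cond (Primrec.and.to_comp.comp h1.decide.to_comp h2')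
    hout.to_comp (Computable.const none)) fun b => ?_
  rw [← Bool.decide_and, Bool.cond_decide, heavyCubeTest]

theorem computable_heavyCubeSearch {F : List (Fin n → ℤ × ℕ) → ℕ → ℤ × ℕ} (hF : Computable₂ F) :
    Computable₂ (heavyCubeSearch F) :=
  computable_decodeBind (computable_heavyCubeTest hF)

theorem den_lt_num_mul_two_pow_iff (v : ℚ≥0) (s : ℕ) :
    ((ratCode (v : ℚ)).2 : ℤ) < (ratCode (v : ℚ)).1 * ((2 ^ s : ℕ) : ℤ) ↔
      (2⁻¹ : ℝ≥0∞) ^ s < ((v : ℝ≥0) : ℝ≥0∞) := by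
  have h1 : (2⁻¹ : ℝ≥0∞) ^ s = (((2⁻¹ : ℝ≥0) ^ s : ℝ≥0) : ℝ≥0∞) := by
    rw [ENNReal.coe_pow, ENNReal.coe_inv two_ne_zero]; rfl
  have hd : (0 : ℝ) < (v : ℚ).den := by exact_mod_cast (v : ℚ).den_pos
  have h2 : ((v : ℝ≥0) : ℝ) = ((v : ℚ).num : ℝ) / (v : ℚ).den := by
    rw [← Rat.cast_def, Rat.cast_nnratCast]; rfl
  rw [h1, ENNReal.coe_lt_coe, ← NNReal.coe_lt_coe, h2, lt_div_iff₀ hd]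
  simp only [ratCode, NNReal.coe_pow, NNReal.coe_inv, NNReal.coe_ofNat, inv_pow]
  rw [inv_mul_lt_iff₀ (by positivity), mul_comm]
  constructor <;> intro h <;> exact_mod_cast h

theorem heavyCubeSearch_sound {μ : OuterMeasure (EuclideanSpace ℝ (Fin n))}
    {f : Finset (Fin n → ℚ) → ℕ → ℚ≥0} {F : List (Fin n → ℤ × ℕ) → ℕ → ℤ × ℕ}
    (hF : ∀ (l : List (Fin n → ℚ)) (t : ℕ), F (l.map pointCode) t = ratCode (f l.toFinset t : ℚ))
    (hf : ∀ A t, ((f A t : ℝ≥0) : ℝ≥0∞) ≤ μ (ratPoint '' (A : Set (Fin n → ℚ))))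
    {p : ℕ × ℕ} {e : ℕ} {v : List Bool} (h : heavyCubeSearch F p e = some v) :
    ∃ m : Fin n → ℤ, v = pointString (dyadicCorner p.1 m) ∧
      (2⁻¹ : ℝ≥0∞) ^ p.2 < μ (dyadicCube p.1 m) := by
  simp only [heavyCubeSearch, decodeBind, heavyCubeTest, Option.bind_eq_some_iff] at h
  obtain ⟨⟨⟨m, L⟩, t⟩, -, h⟩ := h
  split_ifs at h with hc
  refine ⟨m, (Option.some.inj h).symm, ?_⟩
  have hmap : L.map (fun c => pointCode (fracPoint c)) = (L.map fracPoint).map pointCode := by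
    simp
  obtain ⟨hin, hlt⟩ := hc
  simp only [hmap, hF] at hlt
  refine ((den_lt_num_mul_two_pow_iff _ _).1 hlt).trans_le ((hf _ _).trans (measure_mono ?_))
  rintro _ ⟨q, hq, rfl⟩
  simp only [List.coe_toFinset, List.mem_map, Set.mem_ofPred_eq] at hq
  obtain ⟨c, hcL, rfl⟩ := hq
  exact codeInCube_pointCode.1 (hin c hcL)

/-- A strict lower bound on mass is semidecidable: a finite part of the cube already exceeds
`2^{-s}`, and so does one of its approximations from below. -/
theorem heavyCubeSearch_complete {μ : OuterMeasure (EuclideanSpace ℝ (Fin n))}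
    (hμ : FinitelySupported μ)
    {f : Finset (Fin n → ℚ) → ℕ → ℚ≥0} {F : List (Fin n → ℤ × ℕ) → ℕ → ℤ × ℕ}
    (hF : ∀ (l : List (Fin n → ℚ)) (t : ℕ), F (l.map pointCode) t = ratCode (f l.toFinset t : ℚ))
    (hf : ∀ A : Finset (Fin n → ℚ), Tendsto (fun t : ℕ => ((f A t : ℝ≥0) : ℝ≥0∞)) atTop
        (𝓝 (μ (ratPoint '' (A : Set (Fin n → ℚ))))))
    {r s : ℕ} {m : Fin n → ℤ} (h : (2⁻¹ : ℝ≥0∞) ^ s < μ (dyadicCube r m)) :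
    ∃ e, heavyCubeSearch F (r, s) e = some (pointString (dyadicCorner r m)) := by
  classical
  -- The mass left outside `A` is below the slack `μ Q - 2^{-s}`, so by subadditivity the part of
  -- `A` in the cube `Q` still exceeds `2^{-s}`.
  obtain ⟨A, hA⟩ := hμ _ (tsub_pos_of_lt h)
  set B := A.filter fun q => ratPoint q ∈ dyadicCube r m with hB
  have hBμ : (2⁻¹ : ℝ≥0∞) ^ s < μ (ratPoint '' (B : Set (Fin n → ℚ))) := by
    by_contra! hle
    have hsub : dyadicCube r m ⊆
        ratPoint '' (B : Set (Fin n → ℚ)) ∪ (ratPoint '' (A : Set (Fin n → ℚ)))ᶜ := by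
      intro x hx
      by_cases hxA : x ∈ ratPoint '' (A : Set (Fin n → ℚ))
      · obtain ⟨q, hq, rfl⟩ := hxA
        exact Or.inl ⟨q, by simpa [hB] using ⟨hq, hx⟩, rfl⟩
      · exact Or.inr hxA
    have hlt : μ (dyadicCube r m) < μ (dyadicCube r m) := by
      calc μ (dyadicCube r m) ≤ μ (ratPoint '' (B : Set (Fin n → ℚ))) +
            μ (ratPoint '' (A : Set (Fin n → ℚ)))ᶜ :=
            (measure_mono hsub).trans (measure_union_le _ _)
        _ ≤ (2⁻¹ : ℝ≥0∞) ^ s + μ (ratPoint '' (A : Set (Fin n → ℚ)))ᶜ := by gcongr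
        _ < (2⁻¹ : ℝ≥0∞) ^ s + (μ (dyadicCube r m) - (2⁻¹ : ℝ≥0∞) ^ s) :=
            ENNReal.add_lt_add_left (by simp) hA
        _ = μ (dyadicCube r m) := add_tsub_cancel_of_le h.le
    exact lt_irrefl _ hlt
  obtain ⟨t, ht⟩ := ((tendsto_order.1 (hf B)).1 _ hBμ).exists
  obtain ⟨e, he⟩ := exists_decodeBind_eq (heavyCubeTest F (r, s)) ((m, B.toList.map pointCode), t)
  refine ⟨e, he.trans ?_⟩
  simp only [heavyCubeTest, List.map_map]
  have hmap : B.toList.map ((fun c => pointCode (fracPoint c)) ∘ pointCode) =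
      B.toList.map pointCode := by
    simp [Function.comp_def, fracPoint_pointCode]
  rw [if_pos]
  refine ⟨fun c hc => ?_, ?_⟩
  · obtain ⟨q, hq, rfl⟩ := List.mem_map.1 hc
    rw [fracPoint_pointCode, codeInCube_pointCode]
    simp only [hB, Finset.mem_toList, Finset.mem_filter] at hq
    exact hq.2
  · simp only [hmap, hF, Finset.toList_toFinset]
    exact (den_lt_num_mul_two_pow_iff _ _).2 ht

/-- The coding theorem for dyadic cubes. -/
theorem exists_pointComplexity_dyadicCorner_le {U : List Bool →. List Bool}
    (hU : IsUniversalPrefixMachine U) {μ : OuterMeasure (EuclideanSpace ℝ (Fin n))}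
    (hμ : StronglyFinite μ) (hμ' : LowerSemicomputable μ) :
    ∃ C : ℕ, ∀ (r s : ℕ) (m : Fin n → ℤ), (2⁻¹ : ℝ≥0∞) ^ s < μ (dyadicCube r m) →
      pointComplexity U (dyadicCorner r m) ≤ s + 2 * (Nat.pair r s).size + C := by
  classical
  obtain ⟨hfs, f, ⟨F, hFc, hF⟩, hf₁, hf₂⟩ := hμ'
  obtain ⟨w, hw⟩ : ∃ w : ℕ, ∑' q : Fin n → ℚ, μ {ratPoint q} ≤ 2 ^ w := by
    obtain ⟨k, hk⟩ := ENNReal.exists_nat_gt hμ.2.ne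
    exact ⟨k, hk.le.trans (by exact_mod_cast Nat.lt_two_pow_self.le)⟩
  have hcard : ∀ (p : ℕ × ℕ) (l : List (List Bool)), l.Nodup →
      (∀ a ∈ l, ∃ e, heavyCubeSearch F p e = some a) → l.length ≤ 2 ^ (p.2 + w) := by
    intro p l hl hle
    have hex : ∀ a ∈ l, ∃ m : Fin n → ℤ, a = pointString (dyadicCorner p.1 m) ∧
        (2⁻¹ : ℝ≥0∞) ^ p.2 < μ (dyadicCube p.1 m) := fun a ha => by
      obtain ⟨e, he⟩ := hle a ha
      exact heavyCubeSearch_sound hF (fun A t => (hf₁ A t t le_rfl).2) he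
    choose! M hM using hex
    -- Each output is the corner of its cube, so distinct outputs come from distinct cubes and the
    -- masses may be summed.
    have hinj : Set.InjOn M l.toFinset := by
      intro a ha b hb hab
      rw [(hM a (by simpa using ha)).1, (hM b (by simpa using hb)).1, hab]
    have h1 : (l.length : ℝ≥0∞) * 2⁻¹ ^ p.2 ≤ 2 ^ w := by
      calc (l.length : ℝ≥0∞) * 2⁻¹ ^ p.2
          = ∑ m ∈ l.toFinset.image M, (2⁻¹ : ℝ≥0∞) ^ p.2 := by
            rw [Finset.sum_const, Finset.card_image_of_injOn hinj, List.toFinset_card_of_nodup hl,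
              nsmul_eq_mul]
        _ ≤ ∑ m ∈ l.toFinset.image M, μ (dyadicCube p.1 m) := by
            refine Finset.sum_le_sum fun m hm => ?_
            obtain ⟨a, ha, rfl⟩ := Finset.mem_image.1 hm
            exact (hM a (by simpa using ha)).2.le
        _ ≤ 2 ^ w := (sum_dyadicCube_le hμ _ _).trans hw
    have h2 : (l.length : ℝ≥0∞) ≤ 2 ^ (p.2 + w) := by
      calc (l.length : ℝ≥0∞) = l.length * 2⁻¹ ^ p.2 * 2 ^ p.2 := by
            rw [mul_assoc, ← mul_pow, ENNReal.inv_mul_cancel (by simp) (by simp), one_pow, mul_one]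
        _ ≤ 2 ^ w * 2 ^ p.2 := by gcongr
        _ = 2 ^ (p.2 + w) := by rw [← pow_add, add_comm]
    exact_mod_cast h2
  obtain ⟨M, hM, hMp⟩ :=
    exists_prefixMachine_of_enumeration (computable_heavyCubeSearch hFc) w hcard
  obtain ⟨c, hc⟩ := hU.universal M hM
  -- The constant collects `w` extra index bits, the separator bit, and the simulation cost `c` of
  -- the universal machine.
  refine ⟨w + 1 + c, fun r s m hm => ?_⟩
  obtain ⟨e, he⟩ := heavyCubeSearch_complete hfs hF hf₂ hm
  obtain ⟨π, hπ, hπM⟩ := hMp (r, s) e _ he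
  obtain ⟨ρ, hρ, hρU⟩ := hc _ _ hπM
  have h1 : pointComplexity U (dyadicCorner r m) ≤ ρ.length := Nat.sInf_le ⟨ρ, hρU, rfl⟩
  simp only at hπ
  omega

/-! ### Comparison of growth rates -/

/-- Stated for individual large `r`, so that it serves both the frequent bounds of a liminf and the
eventual bounds of a limsup. -/
theorem eventually_div_le_of_growth_le {a b : ℕ → EReal} {k : ℕ}
    (h : ∀ ε : ℝ, 0 < ε → ∀ᶠ r : ℕ in atTop,
      a r ≤ ((1 + ε : ℝ) : EReal) * b (r + k) + ((ε * r : ℝ) : EReal))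
    {y z : ℝ} (hyz : y < z) :
    ∀ᶠ r : ℕ in atTop, b (r + k) / (((r + k : ℕ) : ℝ) : EReal) < (y : EReal) →
      a r / ((r : ℝ) : EReal) ≤ (z : EReal) := by
  -- Half of the gap `z - y` pays for the terms with `ε`, the other half, for large `r`, for the
  -- shift by `k`.
  set ε : ℝ := (z - y) / (2 * (|y| + 1)) with hε
  have hy0 := abs_nonneg y
  have hε0 : 0 < ε := div_pos (sub_pos.2 hyz) (by positivity)
  have hεy : ε * (|y| + 1) = (z - y) / 2 := by rw [hε]; field_simp
  have hlarge : ∀ᶠ r : ℕ in atTop, (1 + ε) * |y| * k ≤ (z - y) / 2 * r := by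
    have ht : Tendsto (fun r : ℕ => (z - y) / 2 * (r : ℝ)) atTop atTop :=
      tendsto_natCast_atTop_atTop.const_mul_atTop (by linarith)
    exact ht.eventually_ge_atTop _
  filter_upwards [h ε hε0, hlarge, eventually_gt_atTop 0] with r hr hl hr0 hb
  have hrpos : (0 : ℝ) < r := by exact_mod_cast hr0
  have hrk : (0 : ℝ) < ((r + k : ℕ) : ℝ) := by exact_mod_cast Nat.add_pos_left hr0 k
  have hb' : b (r + k) ≤ ((((r + k : ℕ) : ℝ) * y : ℝ) : EReal) := by
    have := (EReal.div_le_iff_le_mul (by exact_mod_cast hrk) (EReal.coe_ne_top _)).1 hb.le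
    rwa [← EReal.coe_mul] at this
  rw [EReal.div_le_iff_le_mul (by exact_mod_cast hrpos) (EReal.coe_ne_top _), ← EReal.coe_mul]
  calc a r ≤ ((1 + ε : ℝ) : EReal) * b (r + k) + ((ε * r : ℝ) : EReal) := hr
    _ ≤ ((1 + ε : ℝ) : EReal) * ((((r + k : ℕ) : ℝ) * y : ℝ) : EReal) + ((ε * r : ℝ) : EReal) := by
        have h0 : (0 : EReal) ≤ ((1 + ε : ℝ) : EReal) := by exact_mod_cast (by linarith)
        exact add_le_add (mul_le_mul_of_nonneg_left hb' h0) le_rfl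
    _ = (((1 + ε) * (((r + k : ℕ) : ℝ) * y) + ε * r : ℝ) : EReal) := by
        rw [← EReal.coe_mul, ← EReal.coe_add]
    _ ≤ ((r * z : ℝ) : EReal) := by
        rw [EReal.coe_le_coe_iff]
        push_cast
        have h1 : y * k ≤ |y| * k := by gcongr; exact le_abs_self y
        have h2 : ε * y * r ≤ ε * |y| * r := by gcongr; exact le_abs_self y
        have h3 : (1 + ε) * (y * k) ≤ (1 + ε) * (|y| * k) := by gcongr
        have h4 : ε * (|y| + 1) * r = (z - y) / 2 * r := by rw [hεy]
        nlinarith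

theorem liminf_div_le_of_growth_le {a b : ℕ → EReal} {k : ℕ}
    (h : ∀ ε : ℝ, 0 < ε → ∀ᶠ r : ℕ in atTop,
      a r ≤ ((1 + ε : ℝ) : EReal) * b (r + k) + ((ε * r : ℝ) : EReal)) :
    liminf (fun r : ℕ => a r / ((r : ℝ) : EReal)) atTop ≤
      liminf (fun r : ℕ => b r / ((r : ℝ) : EReal)) atTop := by
  rw [← EReal.le_of_forall_lt_iff_le]
  intro z hz
  obtain ⟨y, hy, hyz⟩ := EReal.lt_iff_exists_real_btwn.1 hz
  have hfr := frequently_lt_of_liminf_lt (by isBoundedDefault) hy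
  have hfr' : ∃ᶠ r : ℕ in atTop, b (r + k) / (((r + k : ℕ) : ℝ) : EReal) < (y : EReal) := by
    rw [frequently_atTop] at hfr ⊢
    intro N
    obtain ⟨r, hr, hb⟩ := hfr (N + k)
    refine ⟨r - k, by omega, ?_⟩
    rwa [Nat.sub_add_cancel (by omega)]
  refine liminf_le_of_frequently_le ?_ (by isBoundedDefault)
  exact (hfr'.and_eventually
    (eventually_div_le_of_growth_le h (EReal.coe_lt_coe_iff.1 hyz))).mono fun r hr => hr.2 hr.1

theorem limsup_div_le_of_growth_le {a b : ℕ → EReal} {k : ℕ}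
    (h : ∀ ε : ℝ, 0 < ε → ∀ᶠ r : ℕ in atTop,
      a r ≤ ((1 + ε : ℝ) : EReal) * b (r + k) + ((ε * r : ℝ) : EReal)) :
    limsup (fun r : ℕ => a r / ((r : ℝ) : EReal)) atTop ≤
      limsup (fun r : ℕ => b r / ((r : ℝ) : EReal)) atTop := by
  rw [← EReal.le_of_forall_lt_iff_le]
  intro z hz
  obtain ⟨y, hy, hyz⟩ := EReal.lt_iff_exists_real_btwn.1 hz
  have hev := (tendsto_add_atTop_nat k).eventually
    (eventually_lt_of_limsup_lt hy (by isBoundedDefault))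
  refine limsup_le_of_le (by isBoundedDefault) ?_
  filter_upwards [hev, eventually_div_le_of_growth_le h (EReal.coe_lt_coe_iff.1 hyz)]
    with r h1 h2 using h2 h1

/-! ### Distances to dyadic corners -/

theorem dist_le_card_mul {x y : EuclideanSpace ℝ (Fin n)} {d : ℝ} (hd : 0 ≤ d)
    (h : ∀ i, |x i - y i| ≤ d) : dist x y ≤ n * d := by
  rw [EuclideanSpace.dist_eq]
  refine Real.sqrt_le_iff.2 ⟨by positivity, ?_⟩
  calc ∑ i, dist (x i) (y i) ^ 2 ≤ ∑ _i : Fin n, d ^ 2 := by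
        refine Finset.sum_le_sum fun i _ => ?_
        rw [Real.dist_eq]
        exact pow_le_pow_left₀ (abs_nonneg _) (h i) 2
    _ = n * d ^ 2 := by simp
    _ ≤ (n * d) ^ 2 := by
        rcases Nat.eq_zero_or_pos n with rfl | hn
        · simp
        · have : (1 : ℝ) ≤ n := by exact_mod_cast hn
          rw [mul_pow]
          gcongr
          nlinarith

theorem card_mul_inv_two_pow_lt (n r : ℕ) : (n : ℝ) * ((2 : ℝ) ^ (r + n))⁻¹ < ((2 : ℝ) ^ r)⁻¹ := by
  have h : (n : ℝ) < 2 ^ n := by exact_mod_cast Nat.lt_two_pow_self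
  rw [pow_add, mul_inv, mul_left_comm]
  refine mul_lt_of_lt_one_right (by positivity) ?_
  rw [← div_eq_mul_inv, div_lt_one (by positivity)]
  exact h

theorem abs_sub_le_dist (x y : EuclideanSpace ℝ (Fin n)) (i : Fin n) : |x i - y i| ≤ dist x y := by
  rw [dist_eq_norm]
  simpa using PiLp.norm_apply_le (x - y) i

/-- Of the `n + 1` extra levels, `n` absorb the dimension factor through `n < 2^n`, and one absorbs
the coordinate error `2`. -/
theorem dist_dyadicCorner_lt {r : ℕ} {m : Fin n → ℤ} {x : EuclideanSpace ℝ (Fin n)}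
    (h : ∀ i, |(m i : ℝ) - x i * 2 ^ (r + n + 1)| ≤ 2) :
    dist (ratPoint (dyadicCorner (r + n + 1) m)) x < ((2 : ℝ) ^ r)⁻¹ := by
  refine lt_of_le_of_lt (dist_le_card_mul (d := ((2 : ℝ) ^ (r + n))⁻¹) (by positivity) fun i => ?_)
    (card_mul_inv_two_pow_lt n r)
  rw [ratPoint_dyadicCorner]
  have hp : (0 : ℝ) < 2 ^ (r + n + 1) := by positivity
  have h1 : (m i : ℝ) / 2 ^ (r + n + 1) - x i =
      ((m i : ℝ) - x i * 2 ^ (r + n + 1)) / 2 ^ (r + n + 1) := by field_simp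
  rw [h1, abs_div, abs_of_pos hp, div_le_iff₀ hp, pow_succ, inv_mul_cancel_left₀ (by positivity)]
  exact h i

/-- The radius equals the side of the cubes, so each floor moves by at most one within the ball.
Then `3^n` cubes cover it, and subadditivity yields a heavy one. -/
theorem exists_ball_cover {μ : OuterMeasure (EuclideanSpace ℝ (Fin n))}
    (x : EuclideanSpace ℝ (Fin n)) (r : ℕ) {c : ℝ≥0∞}
    (h : 3 ^ n * c < μ (Metric.ball x ((2 : ℝ) ^ r)⁻¹)) :
    ∃ m : Fin n → ℤ, (∀ i, |(m i : ℝ) - x i * 2 ^ r| ≤ 2) ∧ c < μ (dyadicCube r m) := by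
  by_contra! hcon
  set T : Finset (Fin n → ℤ) := Fintype.piFinset fun i =>
    Finset.Icc (⌊x i * 2 ^ r⌋ - 1) (⌊x i * 2 ^ r⌋ + 1) with hT
  have hcard : T.card = 3 ^ n := by
    rw [hT, Fintype.card_piFinset]
    simp only [Int.card_Icc]
    have : ∀ i : Fin n, (⌊x i * 2 ^ r⌋ + 1 + 1 - (⌊x i * 2 ^ r⌋ - 1)).toNat = 3 := fun i => by omega
    simp [this]
  have hsub : Metric.ball x ((2 : ℝ) ^ r)⁻¹ ⊆ ⋃ m ∈ T, dyadicCube r m := by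
    intro y hy
    refine Set.mem_iUnion₂.2 ⟨fun i => ⌊y i * 2 ^ r⌋, ?_, mem_dyadicCube_iff_floor.2 fun i => rfl⟩
    rw [hT, Fintype.mem_piFinset]
    intro i
    have hi : |y i - x i| < ((2 : ℝ) ^ r)⁻¹ := (abs_sub_le_dist y x i).trans_lt hy
    have hp : (0 : ℝ) < 2 ^ r := by positivity
    rw [inv_eq_one_div, lt_div_iff₀ hp, ← abs_of_pos hp, ← abs_mul, sub_mul,
      abs_lt] at hi
    have h3 := Int.floor_le (x i * 2 ^ r)
    have h4 := Int.lt_floor_add_one (x i * 2 ^ r)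
    have h5 := Int.floor_le (y i * 2 ^ r)
    refine Finset.mem_Icc.2 ⟨Int.le_floor.2 (by push_cast; linarith), Int.lt_add_one_iff.1 ?_⟩
    have : (⌊y i * 2 ^ r⌋ : ℝ) < ⌊x i * 2 ^ r⌋ + 1 + 1 := by linarith
    exact_mod_cast this
  refine absurd h (not_lt.2 ?_)
  calc μ (Metric.ball x ((2 : ℝ) ^ r)⁻¹) ≤ ∑ m ∈ T, μ (dyadicCube r m) :=
        (measure_mono hsub).trans (measure_biUnion_finset_le _ _)
    _ ≤ ∑ _m ∈ T, c := by
        refine Finset.sum_le_sum fun m hm => hcon m fun i => ?_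
        rw [hT, Fintype.mem_piFinset] at hm
        have := Finset.mem_Icc.1 (hm i)
        have h1 : (⌊x i * 2 ^ r⌋ : ℝ) - 1 ≤ m i := by exact_mod_cast this.1
        have h2 : (m i : ℝ) ≤ ⌊x i * 2 ^ r⌋ + 1 := by exact_mod_cast this.2
        have h3 := Int.floor_le (x i * 2 ^ r)
        have h4 := Int.lt_floor_add_one (x i * 2 ^ r)
        rw [abs_le]
        constructor <;> linarith
    _ = 3 ^ n * c := by rw [Finset.sum_const, hcard, nsmul_eq_mul]; norm_cast

/-! ### Complexity is attained -/

theorem IsUniversalPrefixMachine.exists_program {U : List Bool →. List Bool}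
    (hU : IsUniversalPrefixMachine U) (w : List Bool) : ∃ π, w ∈ U π := by
  -- The machine whose only program is the empty string, with output `w`. It rules out the default
  -- value `0` of `sInf ∅`.
  let M : List Bool →. List Bool := fun π => ((if π = [] then some w else none : Option (List Bool)) :
    Part (List Bool))
  have hdom : ∀ π, (M π).Dom → π = [] := fun π hπ => by
    by_contra h
    simp [M, h] at hπ
  have hM : IsPrefixMachine M := by
    refine ⟨Computable.ofOption (Primrec.to_comp (Primrec.ite
      (Primrec.eq.comp Primrec.id (Primrec.const [])) (Primrec.const _) (Primrec.const _))), ?_⟩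
    intro π ρ hπ hρ _
    rw [hdom π hπ, hdom ρ hρ]
  obtain ⟨c, hc⟩ := hU.universal M hM
  obtain ⟨ρ, -, hρ⟩ := hc [] w (by simp [M])
  exact ⟨ρ, hρ⟩

theorem exists_length_eq_pointComplexity {U : List Bool →. List Bool}
    (hU : IsUniversalPrefixMachine U) (q : Fin n → ℚ) :
    ∃ π, pointString q ∈ U π ∧ π.length = pointComplexity U q := by
  obtain ⟨π, hπ⟩ := hU.exists_program (pointString q)
  obtain ⟨ρ, hρ, hl⟩ := Nat.sInf_mem (s := {k : ℕ | ∃ π : List Bool, pointString q ∈ U π ∧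
    k = π.length}) ⟨_, π, hπ, rfl⟩
  exact ⟨ρ, hρ, hl.symm⟩

theorem exists_pointComplexity_eq_complexityAt (U : List Bool →. List Bool) (r : ℕ)
    (x : EuclideanSpace ℝ (Fin n)) : ∃ q : Fin n → ℚ, dist (ratPoint q) x < ((2 : ℝ) ^ r)⁻¹ ∧
      complexityAt U r x = pointComplexity U q := by
  refine Nat.sInf_mem (s := {k : ℕ | ∃ q : Fin n → ℚ, dist (ratPoint q) x < ((2 : ℝ) ^ r)⁻¹ ∧
    k = pointComplexity U q}) ⟨_, dyadicCorner (r + n + 1) fun i => ⌊x i * 2 ^ (r + n + 1)⌋,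
      dist_dyadicCorner_lt fun i => ?_, rfl⟩
  have h3 := Int.floor_le (x i * 2 ^ (r + n + 1))
  have h4 := Int.lt_floor_add_one (x i * 2 ^ (r + n + 1))
  rw [abs_le]
  constructor <;> linarith

/-! ### The two bounds -/

theorem LocallyOptimal.exists_le_measure_ball {U : List Bool →. List Bool}
    (hU : IsUniversalPrefixMachine U) {μ : OuterMeasure (EuclideanSpace ℝ (Fin n))}
    (hμ : LocallyOptimal μ) : ∃ β : ℕ → ℝ, (∀ r, 0 < β r) ∧
      (fun r : ℕ => Real.logb 2 (β r)) =o[atTop] (fun r : ℕ => (r : ℝ)) ∧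
      ∀ (x : EuclideanSpace ℝ (Fin n)) (r : ℕ),
        ENNReal.ofReal (β (r + 1 + n) * (1 / 2) ^ complexityAt U (r + 1) x) ≤
          μ (Metric.ball x ((2 : ℝ) ^ r)⁻¹) := by
  obtain ⟨β, hβ, hβo, h⟩ := hμ.dominates _ (programMeasure_stronglyFinite hU.isPrefixMachine)
    (programMeasure_lowerSemicomputable hU.isPrefixMachine)
  refine ⟨β, hβ, hβo, fun x r => ?_⟩
  obtain ⟨q, hq, hK⟩ := exists_pointComplexity_eq_complexityAt U (r + 1) x
  obtain ⟨π, hπ, hl⟩ := exists_length_eq_pointComplexity hU q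
  -- At level `r + 1 + n` every point of the cube is within `2^{-(r+1)}` of `q`, which is itself
  -- within `2^{-(r+1)}` of `x`.
  set m : Fin n → ℤ := fun i => ⌊ratPoint q i * 2 ^ (r + 1 + n)⌋
  have hqm : ratPoint q ∈ dyadicCube (r + 1 + n) m := mem_dyadicCube_iff_floor.2 fun i => rfl
  have hsub : dyadicCube (r + 1 + n) m ⊆ Metric.ball x ((2 : ℝ) ^ r)⁻¹ := by
    intro y hy
    have h1 : dist y (ratPoint q) < ((2 : ℝ) ^ (r + 1))⁻¹ := by
      refine lt_of_le_of_lt (dist_le_card_mul (d := ((2 : ℝ) ^ (r + 1 + n))⁻¹) (by positivity)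
        fun i => ?_) (card_mul_inv_two_pow_lt n (r + 1))
      have hy' := hy i
      have hq' := hqm i
      rw [add_div, one_div] at hy' hq'
      rw [abs_le]
      constructor <;> linarith [hy'.1, hy'.2, hq'.1, hq'.2]
    have h2 : ((2 : ℝ) ^ (r + 1))⁻¹ + ((2 : ℝ) ^ (r + 1))⁻¹ = ((2 : ℝ) ^ r)⁻¹ := by
      rw [pow_succ, mul_inv]; ring
    rw [Metric.mem_ball]
    linarith [dist_triangle y (ratPoint q) x]
  calc ENNReal.ofReal (β (r + 1 + n) * (1 / 2) ^ complexityAt U (r + 1) x)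
      = ENNReal.ofReal (β (r + 1 + n)) * programWeight π := by
        rw [ENNReal.ofReal_mul (hβ _).le, programWeight_eq_ofReal, hl, hK]
    _ ≤ ENNReal.ofReal (β (r + 1 + n)) * programMeasure U n (dyadicCube (r + 1 + n) m) := by
        gcongr
        exact programWeight_le_programMeasure hπ hqm
    _ ≤ μ (dyadicCube (r + 1 + n) m) := h _ _ ⟨m, rfl⟩
    _ ≤ μ (Metric.ball x ((2 : ℝ) ^ r)⁻¹) := measure_mono hsub

theorem exists_complexityAt_le {U : List Bool →. List Bool}
    (hU : IsUniversalPrefixMachine U) {μ : OuterMeasure (EuclideanSpace ℝ (Fin n))}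
    (hμ : StronglyFinite μ) (hμ' : LowerSemicomputable μ) :
    ∃ C : ℕ, ∀ (x : EuclideanSpace ℝ (Fin n)) (r s : ℕ),
      3 ^ n * (2⁻¹ : ℝ≥0∞) ^ s < μ (Metric.ball x ((2 : ℝ) ^ (r + n + 1))⁻¹) →
        complexityAt U r x ≤ s + 2 * (Nat.pair (r + n + 1) s).size + C := by
  obtain ⟨C, hC⟩ := exists_pointComplexity_dyadicCorner_le hU hμ hμ'
  refine ⟨C, fun x r s h => ?_⟩
  obtain ⟨m, hm, hlt⟩ := exists_ball_cover x (r + n + 1) h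
  refine le_trans (Nat.sInf_le ⟨_, dist_dyadicCorner_lt hm, rfl⟩) (hC _ _ _ hlt)

/-! ### Logarithms -/

theorem negLogTwo_antitone : Antitone negLogTwo := fun a b h => by
  have h2 : (0 : EReal) ≤ ((Real.log 2 : ℝ) : EReal) := by
    exact_mod_cast (Real.log_pos one_lt_two).le
  exact EReal.div_le_div_right_of_nonneg h2
    (ENNReal.log_monotone (ENNReal.inv_le_inv.2 h))

theorem negLogTwo_ofReal {c : ℝ} (hc : 0 < c) :
    negLogTwo (ENNReal.ofReal c) = ((-Real.logb 2 c : ℝ) : EReal) := by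
  rw [negLogTwo, ENNReal.log_inv, ENNReal.log_ofReal_of_pos hc, ← EReal.coe_neg, ← EReal.coe_div,
    Real.logb, neg_div]

theorem sq_size_le (k : ℕ) : k.size ^ 2 ≤ 8 * k := by
  have key : ∀ j : ℕ, (j + 1) ^ 2 ≤ 8 * 2 ^ j := by
    intro j
    induction j with
    | zero => norm_num
    | succ j ih =>
      rw [pow_succ 2]
      -- The doubling step `(j + 2)^2 ≤ 2 (j + 1)^2` holds only from `j = 2` on.
      rcases j with _ | _ | j
      · norm_num
      · norm_num
      · have : (j + 1 + 1 + 1 + 1) ^ 2 ≤ 2 * (j + 1 + 1 + 1) ^ 2 := by ring_nf; nlinarith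
        linarith
  rcases Nat.eq_zero_or_pos k.size with h | h
  · rw [h]; simp
  · obtain ⟨j, hj⟩ := Nat.exists_eq_succ_of_ne_zero h.ne'
    have h1 : 2 ^ j ≤ k := Nat.lt_size.1 (by omega)
    rw [hj]
    exact (key j).trans (by gcongr)

theorem size_pair_le (r s : ℕ) : (Nat.pair r s).size ≤ 2 * (r + s + 1).size := by
  rw [Nat.size_le]
  calc Nat.pair r s < (max r s + 1) ^ 2 := Nat.pair_lt_max_add_one_sq r s
    _ ≤ (r + s + 1) ^ 2 := by gcongr; omega
    _ ≤ (2 ^ (r + s + 1).size) ^ 2 := by gcongr; exact (Nat.lt_size_self _).le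
    _ = 2 ^ (2 * (r + s + 1).size) := by rw [← pow_mul, mul_comm]

/-- No bound of `s` by a multiple of `r` is assumed, so the logarithmic overhead is charged to both
with a small factor. The charge to `s` is the source of the factor `1 + ε` in the growth comparison.
-/
theorem size_pair_le_linear {ε : ℝ} (hε : 0 < ε) (r s : ℕ) :
    ((Nat.pair r s).size : ℝ) ≤ 2 * (ε * (r + s + 1) + 2 / ε) := by
  have h1 : ((Nat.pair r s).size : ℝ) ≤ 2 * (r + s + 1).size := by exact_mod_cast size_pair_le r s
  have h2 : (((r + s + 1).size : ℝ)) ^ 2 ≤ 8 * (r + s + 1) := by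
    exact_mod_cast sq_size_le (r + s + 1)
  set k : ℝ := ((r + s + 1).size : ℝ)
  have h3 : k ≤ ε * (k ^ 2 / 8) + 2 / ε := by
    -- Completing the square turns the quadratic bound on `k` into a linear one with small slope.
    have : ε * (k ^ 2 / 8) + 2 / ε - k = (ε * k - 4) ^ 2 / (8 * ε) := by field_simp; ring
    have h : 0 ≤ (ε * k - 4) ^ 2 / (8 * ε) := by positivity
    linarith
  have h4 : ε * (k ^ 2 / 8) ≤ ε * (r + s + 1) := by gcongr; linarith
  linarith

theorem LocallyOptimal.eventually_negLogTwo_le {U : List Bool →. List Bool}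
    (hU : IsUniversalPrefixMachine U) {μ : OuterMeasure (EuclideanSpace ℝ (Fin n))}
    (hμ : LocallyOptimal μ) (x : EuclideanSpace ℝ (Fin n)) {ε : ℝ} (hε : 0 < ε) :
    ∀ᶠ r : ℕ in atTop, negLogTwo (μ (Metric.ball x ((2 : ℝ) ^ r)⁻¹)) ≤
      ((1 + ε : ℝ) : EReal) * ((complexityAt U (r + 1) x : ℝ) : EReal) +
        ((ε * r : ℝ) : EReal) := by
  obtain ⟨β, hβ, hβo, h⟩ := hμ.exists_le_measure_ball hU
  have hβ' := (tendsto_add_atTop_nat (1 + n)).eventually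
    -- Half of `ε` suffices because the level `r + 1 + n` is eventually at most `2 r`.
    (hβo.bound (half_pos hε))
  filter_upwards [hβ', eventually_ge_atTop (1 + n)] with r hr hrn
  refine (negLogTwo_antitone (h x r)).trans ?_
  rw [negLogTwo_ofReal (mul_pos (hβ _) (by positivity)), ← EReal.coe_mul, ← EReal.coe_add,
    EReal.coe_le_coe_iff, Real.logb_mul (hβ _).ne' (by positivity), one_div, Real.logb_pow,
    Real.logb_inv, Real.logb_self_eq_one one_lt_two]
  rw [← add_assoc, Real.norm_eq_abs, Real.norm_of_nonneg (by positivity)] at hr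
  have h1 := neg_le_abs (Real.logb 2 (β (r + 1 + n)))
  have h2 : ((r + 1 + n : ℕ) : ℝ) ≤ 2 * r := by exact_mod_cast (by omega)
  have h3 : ε / 2 * ((r + 1 + n : ℕ) : ℝ) ≤ ε / 2 * (2 * r) := by gcongr
  have h4 : 0 ≤ ε * (complexityAt U (r + 1) x : ℝ) := by positivity
  linarith

theorem neg_le_neg_logb_two {c : ℝ} (hc : 0 < c) {w : ℕ} (hw : c ≤ 2 ^ w) :
    -(w : ℝ) ≤ -Real.logb 2 c := by
  have : Real.logb 2 c ≤ Real.logb 2 (2 ^ w) := Real.logb_le_logb_of_le one_lt_two hc hw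
  rw [Real.logb_pow, Real.logb_self_eq_one one_lt_two] at this
  linarith

theorem exists_three_pow_mul_lt {c : ℝ} (hc : 0 < c) (n : ℕ) {w : ℕ} (hw : c ≤ 2 ^ w) :
    ∃ s : ℕ, 3 ^ n * (2⁻¹ : ℝ≥0∞) ^ s < ENNReal.ofReal c ∧
      (s : ℝ) ≤ -Real.logb 2 c + 2 * n + w + 1 := by
  set y := -Real.logb 2 c
  have hyw : -(w : ℝ) ≤ y := neg_le_neg_logb_two hc hw
  -- The summand `2 n` pays for `3^n ≤ 4^n`. The mass may exceed `1`, so `y` can be negative and the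
  -- natural floor can truncate; adding `w` keeps the upper bound on `s` valid.
  refine ⟨⌊y + 2 * n⌋₊ + 1, ?_, ?_⟩
  · have hs : y + 2 * n < ((⌊y + 2 * n⌋₊ + 1 : ℕ) : ℝ) := by
      push_cast; exact Nat.lt_floor_add_one _
    set s := ⌊y + 2 * n⌋₊ + 1
    have h1 : (3 : ℝ≥0∞) ^ n * 2⁻¹ ^ s = ENNReal.ofReal (3 ^ n * (1 / 2) ^ s) := by
      rw [ENNReal.ofReal_mul (by positivity), ENNReal.ofReal_pow (by norm_num),
        ENNReal.ofReal_pow (by norm_num), one_div, ENNReal.ofReal_inv_of_pos two_pos]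
      simp
    rw [h1, ENNReal.ofReal_lt_ofReal_iff hc]
    have h2 : ((1 / 2 : ℝ)) ^ s = (2 : ℝ) ^ (-(s : ℝ)) := by
      rw [Real.rpow_neg two_pos.le, Real.rpow_natCast, one_div, inv_pow]
    have h3 : (2 : ℝ) ^ (-(s : ℝ)) < 2 ^ (Real.logb 2 c - 2 * n) :=
      Real.rpow_lt_rpow_of_exponent_lt one_lt_two (by linarith)
    have h4 : (2 : ℝ) ^ (Real.logb 2 c - 2 * n) = c / 4 ^ n := by
      rw [Real.rpow_sub two_pos, Real.rpow_logb two_pos (by norm_num) hc, Real.rpow_mul two_pos.le,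
        Real.rpow_natCast]
      norm_num
    rw [h2]
    calc (3 : ℝ) ^ n * 2 ^ (-(s : ℝ)) < 3 ^ n * (c / 4 ^ n) := by
          rw [← h4]; gcongr
      _ ≤ 4 ^ n * (c / 4 ^ n) := by gcongr; norm_num
      _ = c := by field_simp
  · have h5 : ⌊y + 2 * n⌋₊ ≤ ⌊y + 2 * n + w⌋₊ := Nat.floor_le_floor (by simp)
    have h6 : (⌊y + 2 * n + w⌋₊ : ℝ) ≤ y + 2 * n + w :=
      Nat.floor_le (by have : (0 : ℝ) ≤ 2 * n := by positivity
                       linarith)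
    have h7 : (⌊y + 2 * n⌋₊ : ℝ) ≤ ⌊y + 2 * n + w⌋₊ := by exact_mod_cast h5
    push_cast
    linarith

theorem eventually_complexityAt_le {U : List Bool →. List Bool}
    (hU : IsUniversalPrefixMachine U) {μ : OuterMeasure (EuclideanSpace ℝ (Fin n))}
    (hμ : StronglyFinite μ) (hμ' : LowerSemicomputable μ) (x : EuclideanSpace ℝ (Fin n))
    {ε : ℝ} (hε : 0 < ε) :
    ∀ᶠ r : ℕ in atTop, ((complexityAt U r x : ℝ) : EReal) ≤
      ((1 + ε : ℝ) : EReal) * negLogTwo (μ (Metric.ball x ((2 : ℝ) ^ (r + (n + 1)))⁻¹)) +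
        ((ε * r : ℝ) : EReal) := by
  obtain ⟨C, hC⟩ := exists_complexityAt_le hU hμ hμ'
  obtain ⟨w, hw⟩ : ∃ w : ℕ, ∀ E, μ E ≤ 2 ^ w := by
    obtain ⟨k, hk⟩ := ENNReal.exists_nat_gt hμ.2.ne
    refine ⟨k, fun E => (hμ.le_tsum E).trans (le_trans (ENNReal.tsum_le_tsum fun q =>
      Set.indicator_le_self _ _ _) (hk.le.trans ?_))⟩
    exact_mod_cast Nat.lt_two_pow_self.le
  set δ := ε / 8 with hδ
  have hδ0 : 0 < δ := by positivity
  -- All terms independent of `r` and of the mass. The last one allows for a negative logarithm,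
  -- which is at least `-w`.
  set D : ℝ := (1 + 4 * δ) * (2 * n + w + 1) + 4 * δ * (n + 2) + 8 / δ + C + 4 * δ * w with hD
  have hlarge : ∀ᶠ r : ℕ in atTop, D ≤ 4 * δ * r :=
    (tendsto_natCast_atTop_atTop.const_mul_atTop (by positivity : 0 < 4 * δ)).eventually_ge_atTop D
  filter_upwards [hlarge] with r hr
  set a := μ (Metric.ball x ((2 : ℝ) ^ (r + (n + 1)))⁻¹) with ha
  have haw : a ≤ 2 ^ w := hw _
  have hatop : a ≠ ∞ := ne_top_of_le_ne_top (by simp) haw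
  -- For a ball of mass zero the right side is `⊤`.
  rcases eq_or_ne a 0 with h0 | h0
  · have : negLogTwo a = ⊤ := by
      rw [h0, negLogTwo, ENNReal.inv_zero, ENNReal.log_top,
        EReal.top_div_of_pos_ne_top (by exact_mod_cast Real.log_pos one_lt_two)
          (EReal.coe_ne_top _)]
    rw [this, EReal.coe_mul_top_of_pos (by linarith), EReal.top_add_coe]
    exact le_top
  · have hc : 0 < a.toReal := ENNReal.toReal_pos h0 hatop
    have hcw : a.toReal ≤ 2 ^ w := by
      have := ENNReal.toReal_mono (by simp) haw
      simpa using this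
    obtain ⟨s, hs, hsle⟩ := exists_three_pow_mul_lt hc n hcw
    rw [ENNReal.ofReal_toReal hatop] at hs
    have hK := hC x r s (by rw [ha, ← add_assoc] at hs; exact hs)
    rw [← ENNReal.ofReal_toReal hatop, negLogTwo_ofReal hc, ← EReal.coe_mul, ← EReal.coe_add,
      EReal.coe_le_coe_iff]
    have hyw : -(w : ℝ) ≤ -Real.logb 2 a.toReal := neg_le_neg_logb_two hc hcw
    set y := -Real.logb 2 a.toReal
    have hK' : (complexityAt U r x : ℝ) ≤ s + 2 * (Nat.pair (r + n + 1) s).size + C := by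
      exact_mod_cast hK
    have hsize := size_pair_le_linear hδ0 (r + n + 1) s
    push_cast at hsize
    have h1 : (1 + 4 * δ) * (s : ℝ) ≤ (1 + 4 * δ) * (y + 2 * n + w + 1) := by gcongr
    have h2 : 4 * δ * (-(w : ℝ)) ≤ 4 * δ * y := by gcongr
    have h3 : ε = 8 * δ := by rw [hδ]; ring
    have h4 : 2 / δ * 4 = 8 / δ := by ring
    rw [h3]
    linarith

end AlgDim

end

theorem mainTheorem1 {n : ℕ} (U : List Bool →. List Bool)
    (hU : AlgDim.IsUniversalPrefixMachine U)
    (μ : MeasureTheory.OuterMeasure (EuclideanSpace ℝ (Fin n)))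
    (hμ : AlgDim.LocallyOptimal μ) (x : EuclideanSpace ℝ (Fin n)) :
    AlgDim.lowerLocalDim μ x = AlgDim.algDim U x ∧
      AlgDim.upperLocalDim μ x = AlgDim.strongAlgDim U x := by
  have hle := fun (ε : ℝ) (hε : 0 < ε) => hμ.eventually_negLogTwo_le hU x hε
  have hge := fun (ε : ℝ) (hε : 0 < ε) =>
    AlgDim.eventually_complexityAt_le hU hμ.stronglyFinite hμ.lowerSemicomputable x hε
  simp only [AlgDim.lowerLocalDim, AlgDim.upperLocalDim, AlgDim.algDim, AlgDim.strongAlgDim,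
    EReal.coe_div]
  constructor
  · exact le_antisymm
      (AlgDim.liminf_div_le_of_growth_le (k := 1)
        (b := fun r => ((AlgDim.complexityAt U r x : ℝ) : EReal)) hle)
      (AlgDim.liminf_div_le_of_growth_le (k := n + 1)
        (b := fun r => AlgDim.negLogTwo (μ (Metric.ball x ((2 : ℝ) ^ r)⁻¹))) hge)
  · exact le_antisymm
      (AlgDim.limsup_div_le_of_growth_le (k := 1)
        (b := fun r => ((AlgDim.complexityAt U r x : ℝ) : EReal)) hle)
      (AlgDim.limsup_div_le_of_growth_le (k := n + 1)
        (b := fun r => AlgDim.negLogTwo (μ (Metric.ball x ((2 : ℝ) ^ r)⁻¹))) hge)
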